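/- All graphs are finite and simple. Let $\chi'(G)$ denote the chromatic index of a graph $G$ (the least number of colors in a proper edge coloring of $G$) and $\Delta(G)$ its maximum degree; $G$ is of Class 2 if $\chi'(G)=\Delta(G)+1$. The chromatic edge stability index $es_{\chi'}(G)$ of a graph $G$ with at least one edge is the minimum number of edges of $G$ whose deletion results in a graph $H$ with $\chi'(H)=\chi'(G)-1$. Theorem. Let $G$ be a graph of even order $n$ which is of Class 2. Then $es_{\chi'}(G)=\frac{n}{2}-1$ if and only if $G\cong K_1\cup K_{n-1}$ or $G\cong K_{2m+1}\cup K_{2m+1}$ for some positive integer $m$, where $\cup$ denotes the disjoint union of graphs and $K_k$ the complete graph of order $k$. -/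

import Mathlib

namespace SimpleGraph

/-- The chromatic index `χ'(G)`: the least number of colors in a proper edge coloring of `G`,
that is, in a proper vertex coloring of the line graph of `G`. -/
noncomputable def chromaticIndex {V : Type*} (G : SimpleGraph V) : ℕ∞ :=
  G.lineGraph.chromaticNumber

/-- A finite graph `G` is of Class 2 if `χ'(G) = Δ(G) + 1`. -/
def IsClassTwo {V : Type*} [Fintype V] (G : SimpleGraph V) [DecidableRel G.Adj] : Prop :=
  G.chromaticIndex = ((G.maxDegree + 1 : ℕ) : ℕ∞)

/-- The chromatic edge stability index `es_{χ'}(G)`: the minimum number of edges of `G` whose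
deletion results in a graph `H` with `χ'(H) = χ'(G) - 1`.
For a finite graph with at least one edge such a set of edges exists. -/
noncomputable def chromaticEdgeStabilityIndex {V : Type*} (G : SimpleGraph V) : ℕ :=
  sInf {k : ℕ | ∃ F : Finset (Sym2 V), (F : Set (Sym2 V)) ⊆ G.edgeSet ∧ F.card = k ∧
    (G.deleteEdges (F : Set (Sym2 V))).chromaticIndex + 1 = G.chromaticIndex}

end SimpleGraph

/-! Suppose the index is `n / 2 - 1`. Deleting a color class of a `(Δ + 1)`-coloring lowers the
chromatic index by one, so every class of every such coloring has at least `n / 2 - 1` edges. This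
is `AllClassesLarge`: a color is missing at no more than two vertices, hence by parity at none or at
exactly two. Every vertex misses some color, as there are `Δ + 1` of them.

Take an edge `xy` of a color `c` that is missing at two vertices, and uncolor it. Now `c` is missing
at more than two vertices, so the edge cannot be colored again without the color `c`. The graph
therefore behaves like a critical one, and Vizing fans at `x` starting with `xy` are elementary
(`not_common_missing`, `fan_elementary`). Counting colors on a fan gives `sum_excess_fan`: the
numbers of missing colors beyond the first add up to one less than the number of fan vertices
missing `c`, so to at most `1`.

If some vertex misses more than two colors, these counts force it to be isolated and all other
vertices to be pairwise adjacent. Otherwise a parity count shows that each vertex `v` misses exactly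
one color `f v`, and vertices are paired by their missing color. Consider only the edges whose color
is missing somewhere. Every vertex outside a pair is joined by them to exactly one of its two
vertices (`defectAdj_or`), and a Kempe change shows that this relation is transitive
(`defectAdj_iff_of_defectAdj`). So these edges form two cliques of equal odd order. A color missing
nowhere would be a perfect matching between the cliques; copying the coloring of one clique to the
other along it frees that color entirely, a contradiction (`exists_missing`).

Conversely, a matching in two disjoint odd cliques misses a vertex of each, and both graphs have
just `(Δ + 1)(n - 2) / 2` edges. Since `Δ` matchings cover at most `Δ(n - 2) / 2` edges, at least `n
/ 2 - 1` must be deleted. -/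

namespace SimpleGraph

open scoped Classical

variable {V : Type*} {G : SimpleGraph V} {C : Type*}

/-! ### Edge colorings as families of involutions. -/

/-- A proper edge coloring of some of the edges of `G`: the color class of `c` is the matching that
joins `v` to `nbr c v` whenever `nbr c v ≠ v`; the color `c` is missing at the fixed points. -/
structure PartialEdgeColoring (G : SimpleGraph V) (C : Type*) where
  /-- the neighbor along the edge of color `c`, or the vertex itself if there is none -/
  nbr : C → V → V
  invol : ∀ c v, nbr c (nbr c v) = v
  adj : ∀ c v, nbr c v ≠ v → G.Adj v (nbr c v)
  inj : ∀ c d v, nbr c v ≠ v → nbr c v = nbr d v → c = d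

namespace PartialEdgeColoring

/-- Every edge is colored. -/
def IsTotal (M : PartialEdgeColoring G C) : Prop :=
  ∀ u v, G.Adj u v → ∃ c, M.nbr c u = v

theorem nbr_eq_comm (M : PartialEdgeColoring G C) {c : C} {u v : V} :
    M.nbr c u = v ↔ M.nbr c v = u :=
  ⟨fun h => h ▸ M.invol c u, fun h => h ▸ M.invol c v⟩

theorem nbr_injective (M : PartialEdgeColoring G C) (c : C) : Function.Injective (M.nbr c) :=
  fun u v h => by rw [← M.invol c u, h, M.invol]

theorem exists_total_of_coloring (φ : G.lineGraph.Coloring C) :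
    ∃ M : PartialEdgeColoring G C, M.IsTotal := by
  have huniq : ∀ {v w w' : V} (h : G.Adj v w) (h' : G.Adj v w'),
      φ ⟨s(v, w), h⟩ = φ ⟨s(v, w'), h'⟩ → w = w' := by
    intro v w w' h h' he
    by_contra hne
    refine φ.valid (v := ⟨s(v, w), h⟩) (w := ⟨s(v, w'), h'⟩) ⟨?_, ⟨v, ?_⟩⟩ he
    · intro hs
      exact hne (Sym2.congr_right.1 (congrArg Subtype.val hs))
    · simp
  let P : C → V → V → Prop := fun c v w => ∃ h : G.Adj v w, φ ⟨s(v, w), h⟩ = c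
  have hP : ∀ {c v w w'}, P c v w → P c v w' → w = w' := by
    rintro c v w w' ⟨h, rfl⟩ ⟨h', e⟩
    exact huniq h h' e.symm
  have hPs : ∀ {c v w}, P c v w → P c w v := by
    rintro c v w ⟨h, rfl⟩
    refine ⟨h.symm, congrArg φ (Subtype.ext Sym2.eq_swap)⟩
  let f : C → V → V := fun c v => if h : ∃ w, P c v w then h.choose else v
  have hf : ∀ {c v w}, P c v w → f c v = w := by
    intro c v w h
    have h' : ∃ w, P c v w := ⟨w, h⟩
    simp only [f, dif_pos h']
    exact hP h'.choose_spec h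
  have hf' : ∀ c v, f c v ≠ v → P c v (f c v) := by
    intro c v h
    by_cases h' : ∃ w, P c v w
    · obtain ⟨w, hw⟩ := h'
      rwa [hf hw]
    · simp [f, h'] at h
  refine ⟨⟨f, ?_, fun c v h => (hf' c v h).1, ?_⟩, ?_⟩
  · intro c v
    by_cases h : f c v = v
    · rw [h, h]
    · exact hf (hPs (hf' c v h))
  · intro c d v h e
    obtain ⟨h1, e1⟩ := hf' c v h
    obtain ⟨h2, e2⟩ := hf' d v (e ▸ h)
    rw [← e1, ← e2]
    congr 3
  · intro u v h
    exact ⟨φ ⟨s(u, v), h⟩, hf ⟨h, rfl⟩⟩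

theorem IsTotal.nonempty_coloring {M : PartialEdgeColoring G C} (hM : M.IsTotal) :
    Nonempty (G.lineGraph.Coloring C) := by
  have h : ∀ e : G.edgeSet, ∃ c, ∀ u v, e.1 = s(u, v) → M.nbr c u = v := by
    rintro ⟨e, he⟩
    induction e with
    | _ u v =>
      obtain ⟨c, hc⟩ := hM u v he
      refine ⟨c, fun a b hab => ?_⟩
      rcases Sym2.eq_iff.1 hab with ⟨rfl, rfl⟩ | ⟨rfl, rfl⟩
      · exact hc
      · exact M.nbr_eq_comm.1 hc
  choose φ hφ using h
  refine ⟨Coloring.mk φ ?_⟩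
  rintro e e' ⟨hne, ⟨v, hv, hv'⟩⟩ heq
  obtain ⟨w, hw⟩ := Sym2.mem_iff_exists.1 hv
  obtain ⟨w', hw'⟩ := Sym2.mem_iff_exists.1 hv'
  refine hne (Subtype.ext ?_)
  rw [hw, hw', ← hφ e v w hw, ← hφ e' v w' hw', heq]

theorem lineGraph_colorable_iff {k : ℕ} :
    G.lineGraph.Colorable k ↔ ∃ M : PartialEdgeColoring G (Fin k), M.IsTotal :=
  ⟨fun ⟨φ⟩ => exists_total_of_coloring φ, fun ⟨_, hM⟩ => hM.nonempty_coloring⟩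

/-! ### Color classes, missing colors and parity. -/

section Finite

variable [Fintype V]

/-- The vertices at which the color `c` is missing. -/
noncomputable def missingAt (M : PartialEdgeColoring G C) (c : C) : Finset V :=
  {v | M.nbr c v = v}

@[simp] theorem mem_missingAt {M : PartialEdgeColoring G C} {c : C} {v : V} :
    v ∈ M.missingAt c ↔ M.nbr c v = v := by simp [missingAt]

theorem card_missingAt_add_card_covered (M : PartialEdgeColoring G C) (c : C) :
    (M.missingAt c).card + (Finset.univ.filter fun v => M.nbr c v ≠ v).card = Fintype.card V :=
  Finset.card_filter_add_card_filter_not (s := Finset.univ) (fun v => M.nbr c v = v)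

/-- The edges of color `c`. -/
noncomputable def colorClass (M : PartialEdgeColoring G C) (c : C) : Finset (Sym2 V) :=
  ({v | M.nbr c v ≠ v} : Finset V).image fun v => s(v, M.nbr c v)

theorem mem_colorClass {M : PartialEdgeColoring G C} {c : C} {u v : V} :
    s(u, v) ∈ M.colorClass c ↔ M.nbr c u = v ∧ u ≠ v := by
  simp only [colorClass, Finset.mem_image, Finset.mem_filter, Finset.mem_univ, true_and,
    Sym2.eq_iff]
  constructor
  · rintro ⟨a, ha, ⟨rfl, rfl⟩ | ⟨rfl, rfl⟩⟩
    · exact ⟨rfl, Ne.symm ha⟩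
    · exact ⟨M.invol _ _, ha⟩
  · rintro ⟨rfl, h⟩
    exact ⟨u, h.symm, Or.inl ⟨rfl, rfl⟩⟩

theorem two_mul_card_colorClass (M : PartialEdgeColoring G C) (c : C) :
    2 * (M.colorClass c).card + (M.missingAt c).card = Fintype.card V := by
  have h1 : ({v | M.nbr c v ≠ v} : Finset V).card = 2 * (M.colorClass c).card := by
    rw [Finset.card_eq_sum_card_image fun v => s(v, M.nbr c v), mul_comm, ← smul_eq_mul,
      ← Finset.sum_const]
    refine Finset.sum_congr rfl fun e he => ?_
    obtain ⟨v, hv, rfl⟩ := Finset.mem_image.1 he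
    have hv' : M.nbr c v ≠ v := by simpa using hv
    rw [Finset.card_eq_two]
    refine ⟨v, M.nbr c v, hv'.symm, ?_⟩
    ext w
    simp only [Finset.mem_filter, Finset.mem_univ, true_and, Finset.mem_insert,
      Finset.mem_singleton, Sym2.eq_iff]
    constructor
    · rintro ⟨-, h | h⟩
      · exact Or.inl h.1
      · exact Or.inr h.1
    · rintro (rfl | rfl)
      · exact ⟨hv', Or.inl ⟨rfl, rfl⟩⟩
      · rw [M.invol]
        exact ⟨hv'.symm, Or.inr ⟨rfl, rfl⟩⟩
  rw [← h1, add_comm]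
  exact M.card_missingAt_add_card_covered c

omit [Fintype V] in
/-- A color class covers an even number of vertices of each set that it preserves. -/
theorem even_card_covered (M : PartialEdgeColoring G C) (c : C) (A : Finset V)
    (hA : ∀ v ∈ A, M.nbr c v ∈ A) : Even (A.filter fun v => M.nbr c v ≠ v).card := by
  -- On the covered vertices the color class is an involution without fixed points, so the ones
  -- cancel in pairs modulo 2.
  have h : ∑ v ∈ A.filter (fun v => M.nbr c v ≠ v), (1 : ZMod 2) = 0 := by
    refine Finset.sum_involution (fun v _ => M.nbr c v) (fun v _ => by decide)
      (fun v hv _ => (Finset.mem_filter.1 hv).2) (fun v hv => ?_) (fun v _ => M.invol c v)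
    obtain ⟨h1, h2⟩ := Finset.mem_filter.1 hv
    refine Finset.mem_filter.2 ⟨hA v h1, ?_⟩
    rw [M.invol]
    exact h2.symm
  rw [Finset.sum_const, nsmul_eq_mul, mul_one] at h
  exact (ZMod.natCast_eq_zero_iff_even).1 h

theorem even_card_missingAt (M : PartialEdgeColoring G C) (hV : Even (Fintype.card V)) (c : C) :
    Even (M.missingAt c).card := by
  have := M.two_mul_card_colorClass c
  rw [← this] at hV
  exact (Nat.even_add.1 hV).1 (even_two_mul _)

theorem IsTotal.card_covering_eq_degree [Fintype C] [DecidableRel G.Adj]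
    {M : PartialEdgeColoring G C} (hM : M.IsTotal) (v : V) :
    (Finset.univ.filter fun c => M.nbr c v ≠ v).card = G.degree v := by
  rw [← G.card_neighborFinset_eq_degree]
  refine Finset.card_bij (fun c _ => M.nbr c v) ?_ ?_ ?_
  · intro c hc
    simpa using M.adj c v (by simpa using hc)
  · intro c hc d _ h
    exact M.inj c d v (by simpa using hc) h
  · intro w hw
    obtain ⟨c, hc⟩ := hM v w (by simpa using hw)
    refine ⟨c, ?_, hc⟩
    simp only [Finset.mem_filter, Finset.mem_univ, true_and, hc]
    exact (G.ne_of_adj (by simpa using hw)).symm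

theorem IsTotal.sum_degree_eq [Fintype C] [DecidableRel G.Adj]
    {M : PartialEdgeColoring G C} (hM : M.IsTotal) :
    ∑ v, G.degree v = ∑ c, (Finset.univ.filter fun v => M.nbr c v ≠ v).card := by
  simp_rw [← hM.card_covering_eq_degree, Finset.card_filter]
  exact Finset.sum_comm

/-! ### Deleting a color class, and the stability index. -/

theorem IsTotal.lineGraph_deleteEdges_colorable {k : ℕ} {M : PartialEdgeColoring G (Fin (k + 1))}
    (hM : M.IsTotal) (c : Fin (k + 1)) :
    (G.deleteEdges (M.colorClass c : Set (Sym2 V))).lineGraph.Colorable k := by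
  let M' : PartialEdgeColoring (G.deleteEdges (M.colorClass c : Set (Sym2 V)))
      {d : Fin (k + 1) // d ≠ c} :=
    { nbr := fun d => M.nbr d
      invol := fun d => M.invol d
      adj := fun d v h => by
        rw [deleteEdges_adj]
        refine ⟨M.adj d v h, fun hm => ?_⟩
        obtain ⟨h1, -⟩ := mem_colorClass.1 (Finset.mem_coe.1 hm)
        exact d.2 (M.inj d c v h h1.symm)
      inj := fun d e v h he => Subtype.ext (M.inj d e v h he) }
  have hM' : M'.IsTotal := by
    intro u v h
    rw [deleteEdges_adj] at h
    obtain ⟨d, hd⟩ := hM u v h.1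
    refine ⟨⟨d, ?_⟩, hd⟩
    rintro rfl
    exact h.2 (Finset.mem_coe.2 (mem_colorClass.2 ⟨hd, h.1.ne⟩))
  obtain ⟨φ⟩ := hM'.nonempty_coloring
  have := φ.colorable
  simpa using this

/-- The deleted matching can be restored with one fresh color, `none`. Hence deleting a class of an
optimal coloring lowers the index by exactly one, not by more. -/
theorem lineGraph_colorable_succ_of_deleteEdges (M : PartialEdgeColoring G C) (c : C) {j : ℕ}
    (h : (G.deleteEdges (M.colorClass c : Set (Sym2 V))).lineGraph.Colorable j) :
    G.lineGraph.Colorable (j + 1) := by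
  obtain ⟨N, hN⟩ := lineGraph_colorable_iff.1 h
  have hne : ∀ d v, N.nbr d v ≠ v → M.nbr c v ≠ N.nbr d v := by
    intro d v hv he
    have := N.adj d v hv
    rw [deleteEdges_adj] at this
    exact this.2 (Finset.mem_coe.2 (mem_colorClass.2 ⟨he, hv.symm⟩))
  let M' : PartialEdgeColoring G (Option (Fin j)) :=
    { nbr := fun o => o.elim (M.nbr c) N.nbr
      invol := by
        rintro (_ | d) v
        · exact M.invol c v
        · exact N.invol d v
      adj := by
        rintro (_ | d) v hv
        · exact M.adj c v hv
        · exact deleteEdges_le _ (N.adj d v hv)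
      inj := by
        rintro (_ | d) (_ | e) v hv he
        · rfl
        · exact absurd he (hne e v fun h => hv (he.trans h))
        · exact absurd he.symm (hne d v hv)
        · exact congrArg some (N.inj d e v hv he) }
  have hM' : M'.IsTotal := by
    intro u v h
    by_cases hm : s(u, v) ∈ M.colorClass c
    · exact ⟨none, (mem_colorClass.1 hm).1⟩
    · obtain ⟨d, hd⟩ := hN u v (by rw [deleteEdges_adj]; exact ⟨h, hm⟩)
      exact ⟨some d, hd⟩
  obtain ⟨φ⟩ := hM'.nonempty_coloring
  have := φ.colorable
  simpa using this

theorem coe_colorClass_subset (M : PartialEdgeColoring G C) (c : C) :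
    (M.colorClass c : Set (Sym2 V)) ⊆ G.edgeSet := by
  intro e he
  induction e with
  | _ u v =>
    obtain ⟨rfl, h⟩ := mem_colorClass.1 (Finset.mem_coe.1 he)
    exact M.adj c u h.symm

theorem IsTotal.chromaticIndex_deleteEdges_colorClass {k : ℕ}
    {M : PartialEdgeColoring G (Fin (k + 1))} (hM : M.IsTotal)
    (hG : G.chromaticIndex = ((k + 1 : ℕ) : ℕ∞)) (c : Fin (k + 1)) :
    (G.deleteEdges (M.colorClass c : Set (Sym2 V))).chromaticIndex + 1 = G.chromaticIndex := by
  have h1 := (hM.lineGraph_deleteEdges_colorable c).chromaticNumber_le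
  unfold chromaticIndex at *
  lift (G.deleteEdges (M.colorClass c : Set (Sym2 V))).lineGraph.chromaticNumber to ℕ using
    ne_top_of_le_ne_top (ENat.natCast_ne_top k) h1 with j hj
  have h2 := (M.lineGraph_colorable_succ_of_deleteEdges c
    (chromaticNumber_le_iff_colorable.1 hj.ge)).chromaticNumber_le
  rw [hG] at h2 ⊢
  norm_cast at *
  omega

theorem IsTotal.chromaticEdgeStabilityIndex_le {k : ℕ}
    {M : PartialEdgeColoring G (Fin (k + 1))} (hM : M.IsTotal)
    (hG : G.chromaticIndex = ((k + 1 : ℕ) : ℕ∞)) (c : Fin (k + 1)) :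
    G.chromaticEdgeStabilityIndex ≤ (M.colorClass c).card :=
  Nat.sInf_le ⟨M.colorClass c, M.coe_colorClass_subset c, rfl,
    hM.chromaticIndex_deleteEdges_colorClass hG c⟩

omit [Fintype V] in
theorem exists_total_of_chromaticIndex {k : ℕ} (hG : G.chromaticIndex = (k : ℕ∞)) :
    ∃ M : PartialEdgeColoring G (Fin k), M.IsTotal :=
  lineGraph_colorable_iff.1 (chromaticNumber_le_iff_colorable.1 hG.le)

theorem exists_card_eq_chromaticEdgeStabilityIndex {k : ℕ}
    (hG : G.chromaticIndex = ((k + 1 : ℕ) : ℕ∞)) :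
    ∃ F : Finset (Sym2 V), (F : Set (Sym2 V)) ⊆ G.edgeSet ∧
      F.card = G.chromaticEdgeStabilityIndex ∧
      (G.deleteEdges (F : Set (Sym2 V))).chromaticIndex = (k : ℕ∞) := by
  obtain ⟨M, hM⟩ := exists_total_of_chromaticIndex hG
  obtain ⟨F, h1, h2, h3⟩ := Nat.sInf_mem (s := {k : ℕ | ∃ F : Finset (Sym2 V),
    (F : Set (Sym2 V)) ⊆ G.edgeSet ∧ F.card = k ∧
    (G.deleteEdges (F : Set (Sym2 V))).chromaticIndex + 1 = G.chromaticIndex})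
    ⟨_, M.colorClass 0, M.coe_colorClass_subset 0, rfl,
      hM.chromaticIndex_deleteEdges_colorClass hG 0⟩
  refine ⟨F, h1, h2, ?_⟩
  rw [hG, Nat.cast_add, Nat.cast_one] at h3
  -- An infinite index plus one would still be infinite, not `k + 1`.
  lift (G.deleteEdges (F : Set (Sym2 V))).chromaticIndex to ℕ using by
    rintro h
    rw [h, top_add] at h3
    exact (ENat.natCast_ne_top (k + 1)) (by simpa using h3.symm) with j
  norm_cast at *
  omega

theorem chromaticEdgeStabilityIndex_pos {k : ℕ}
    (hG : G.chromaticIndex = ((k + 1 : ℕ) : ℕ∞)) : 0 < G.chromaticEdgeStabilityIndex := by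
  obtain ⟨F, -, h2, h3⟩ := exists_card_eq_chromaticEdgeStabilityIndex hG
  rw [← h2, Nat.pos_iff_ne_zero]
  intro h
  rw [Finset.card_eq_zero.1 h] at h3
  simp only [Finset.coe_empty, deleteEdges_empty] at h3
  rw [h3] at hG
  norm_cast at hG
  omega

end Finite
end PartialEdgeColoring
end SimpleGraph

namespace SimpleGraph
namespace PartialEdgeColoring

open scoped Classical

variable {V : Type*} {G : SimpleGraph V} {C : Type*}

/-! ### Modifying a coloring -/

/-- Replace the color class of `c`. -/
noncomputable def setClass (M : PartialEdgeColoring G C) (c : C) (g : V → V)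
    (hinv : ∀ v, g (g v) = v) (hadj : ∀ v, g v ≠ v → G.Adj v (g v))
    (hinj : ∀ d v, d ≠ c → g v ≠ v → g v ≠ M.nbr d v) : PartialEdgeColoring G C where
  nbr d := if d = c then g else M.nbr d
  invol d v := by
    split_ifs
    · exact hinv v
    · exact M.invol d v
  adj d v := by
    split_ifs
    · exact hadj v
    · exact M.adj d v
  inj d e v := by
    split_ifs with h1 h2 h2
    · intros; rw [h1, h2]
    · intro h h'; exact absurd h' (hinj e v h2 h)
    · intro h h'; exact absurd h'.symm (hinj d v h1 (h' ▸ h))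
    · exact M.inj d e v

/-- Give the uncolored edge `xy` the color `c`, and uncolor the edge of color `c` at `x`. -/
noncomputable def recolor (M : PartialEdgeColoring G C) (c : C) (x y : V) (hadj : G.Adj x y)
    (hy : M.nbr c y = y) (hxy : ∀ d, M.nbr d x ≠ y) : PartialEdgeColoring G C :=
  M.setClass c (fun v => if v = x then y else if v = y then x else if v = M.nbr c x then v
      else M.nbr c v)
    (by
      intro v
      have h1 := M.invol c
      have h2 := hadj.ne
      grind)
    (by
      intro v
      have h1 := M.adj c v
      have h2 := hadj.symm
      grind)
    (by
      intro d v hd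
      have h1 := M.inj d c v
      have h2 := hxy d
      have h3 := M.nbr_eq_comm (c := d) (u := x) (v := y)
      grind)

theorem recolor_nbr_of_ne (M : PartialEdgeColoring G C) {c d : C} {x y : V} (hadj : G.Adj x y)
    (hy : M.nbr c y = y) (hxy : ∀ d, M.nbr d x ≠ y) (hd : d ≠ c) :
    (M.recolor c x y hadj hy hxy).nbr d = M.nbr d := by
  simp [recolor, setClass, hd]

theorem recolor_nbr (M : PartialEdgeColoring G C) {c : C} {x y : V} (hadj : G.Adj x y)
    (hy : M.nbr c y = y) (hxy : ∀ d, M.nbr d x ≠ y) (v : V) :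
    (M.recolor c x y hadj hy hxy).nbr c v = if v = x then y else if v = y then x
      else if v = M.nbr c x then v else M.nbr c v := by
  simp [recolor, setClass]

/-- Uncolor the edge of color `c` at `x`. -/
noncomputable def uncolor (M : PartialEdgeColoring G C) (c : C) (x : V) :
    PartialEdgeColoring G C :=
  M.setClass c (fun v => if v = x ∨ v = M.nbr c x then v else M.nbr c v)
    (by
      intro v
      have h1 := M.invol c
      grind)
    (by
      intro v
      have h1 := M.adj c v
      grind)
    (by
      intro d v hd
      have h1 := M.inj d c v
      grind)

theorem uncolor_nbr_of_ne (M : PartialEdgeColoring G C) {c d : C} (x : V) (hd : d ≠ c) :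
    (M.uncolor c x).nbr d = M.nbr d := by
  simp [uncolor, setClass, hd]

theorem uncolor_nbr (M : PartialEdgeColoring G C) (c : C) (x v : V) :
    (M.uncolor c x).nbr c v = if v = x ∨ v = M.nbr c x then v else M.nbr c v := by
  simp [uncolor, setClass]

/-- Exchange the colors `c` and `d` on a set of vertices that is closed under both. -/
noncomputable def kempeSwap (M : PartialEdgeColoring G C) (c d : C) (K : Set V)
    (hK : ∀ v ∈ K, M.nbr c v ∈ K ∧ M.nbr d v ∈ K) : PartialEdgeColoring G C where
  nbr e v := if v ∈ K then M.nbr (Equiv.swap c d e) v else M.nbr e v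
  invol e v := by
    have h1 : v ∉ K → M.nbr e v ∈ K → e ≠ c ∧ e ≠ d := by
      intro hv h
      constructor <;> rintro rfl
      · exact hv (M.invol e v ▸ (hK _ h).1)
      · exact hv (M.invol e v ▸ (hK _ h).2)
    have h2 : v ∈ K → M.nbr (Equiv.swap c d e) v ∉ K → e ≠ c ∧ e ≠ d := by
      intro hv h
      constructor <;> rintro rfl
      · exact h (by simpa using (hK v hv).2)
      · exact h (by simpa using (hK v hv).1)
    have h3 := M.invol e v
    have h4 := M.invol (Equiv.swap c d e) v
    have h5 := Equiv.swap_apply_of_ne_of_ne (a := c) (b := d) (x := e)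
    grind
  adj e v := by
    have h1 := M.adj e v
    have h2 := M.adj (Equiv.swap c d e) v
    grind
  inj e f v := by
    split_ifs
    · intro h h'
      exact (Equiv.swap c d).injective (M.inj _ _ v h h')
    · exact M.inj e f v

section Swap

variable {M : PartialEdgeColoring G C} {c d : C} {K : Set V}
  {hK : ∀ v ∈ K, M.nbr c v ∈ K ∧ M.nbr d v ∈ K}

theorem kempeSwap_nbr_of_mem {e : C} {v : V} (hv : v ∈ K) :
    (M.kempeSwap c d K hK).nbr e v = M.nbr (Equiv.swap c d e) v := by
  simp [kempeSwap, hv]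

theorem kempeSwap_nbr_of_notMem {e : C} {v : V} (hv : v ∉ K) :
    (M.kempeSwap c d K hK).nbr e v = M.nbr e v := by
  simp [kempeSwap, hv]

theorem kempeSwap_nbr_of_ne {e : C} (hc : e ≠ c) (hd : e ≠ d) :
    (M.kempeSwap c d K hK).nbr e = M.nbr e := by
  funext v
  simp [kempeSwap, Equiv.swap_apply_of_ne_of_ne hc hd]

theorem IsTotal.kempeSwap (hM : M.IsTotal) : (M.kempeSwap c d K hK).IsTotal := by
  intro u v h
  obtain ⟨e, he⟩ := hM u v h
  by_cases hu : u ∈ K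
  · refine ⟨Equiv.swap c d e, ?_⟩
    rw [kempeSwap_nbr_of_mem hu, Equiv.swap_apply_self, he]
  · exact ⟨e, by rw [kempeSwap_nbr_of_notMem hu, he]⟩

end Swap

/-! ### Kempe chains -/

/-- A color class as a permutation. -/
def perm (M : PartialEdgeColoring G C) (c : C) : Equiv.Perm V :=
  Function.Involutive.toPerm (M.nbr c) (M.invol c)

/-- For `x` at which `c` or `d` is missing: `u` is on the `(c, d)`-chain starting at `x`. -/
def Linked (M : PartialEdgeColoring G C) (c d : C) (x u : V) : Prop :=
  (M.perm c * M.perm d).SameCycle x u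

theorem perm_mul_self (M : PartialEdgeColoring G C) (c : C) : M.perm c * M.perm c = 1 := by
  ext v
  exact M.invol c v

theorem perm_inv (M : PartialEdgeColoring G C) (c : C) : (M.perm c)⁻¹ = M.perm c :=
  inv_eq_of_mul_eq_one_left (M.perm_mul_self c)

theorem linked_comm (M : PartialEdgeColoring G C) {c d : C} {x u : V} :
    M.Linked c d x u ↔ M.Linked d c x u := by
  unfold Linked
  rw [← Equiv.Perm.sameCycle_inv, mul_inv_rev, perm_inv, perm_inv]

theorem Linked.symm {M : PartialEdgeColoring G C} {c d : C} {x u : V} (h : M.Linked c d x u) :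
    M.Linked c d u x := Equiv.Perm.SameCycle.symm h

theorem Linked.trans {M : PartialEdgeColoring G C} {c d : C} {x u v : V} (h : M.Linked c d x u)
    (h' : M.Linked c d u v) : M.Linked c d x v := Equiv.Perm.SameCycle.trans h h'

theorem Linked.refl (M : PartialEdgeColoring G C) (c d : C) (x : V) : M.Linked c d x x :=
  Equiv.Perm.SameCycle.refl _ _

/-- Two involutions generate a dihedral group: conjugation by one of them inverts the rotation,
their product. As `c` fixes `x`, it acts on the orbit of `x` by negating exponents. -/
theorem nbr_zpow (M : PartialEdgeColoring G C) {c d : C} {x : V} (hx : M.nbr c x = x) (i : ℤ) :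
    M.nbr c (((M.perm c * M.perm d) ^ i) x) = ((M.perm c * M.perm d) ^ (-i)) x := by
  have h : M.perm c * (M.perm c * M.perm d) ^ i = (M.perm c * M.perm d) ^ (-i) * M.perm c := by
    have h1 : M.perm c * (M.perm c * M.perm d) * (M.perm c)⁻¹ = (M.perm c * M.perm d)⁻¹ := by
      rw [← mul_assoc, perm_mul_self, one_mul, mul_inv_rev, perm_inv, perm_inv]
    rw [zpow_neg, ← inv_zpow, ← h1, conj_zpow]
    group
  calc M.nbr c (((M.perm c * M.perm d) ^ i) x)
      = (M.perm c * (M.perm c * M.perm d) ^ i) x := rfl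
    _ = ((M.perm c * M.perm d) ^ (-i)) (M.nbr c x) := by rw [h]; rfl
    _ = _ := by rw [hx]

theorem nbr_zpow' (M : PartialEdgeColoring G C) {c d : C} {x : V} (hx : M.nbr c x = x) (i : ℤ) :
    M.nbr d (((M.perm c * M.perm d) ^ i) x) = ((M.perm c * M.perm d) ^ (-i - 1)) x := by
  have h : ((M.perm d) * (M.perm c * M.perm d) ^ i : Equiv.Perm V)
      = M.perm c * (M.perm c * M.perm d) ^ (i + 1) := by
    rw [add_comm, zpow_add, zpow_one, ← mul_assoc, ← mul_assoc, perm_mul_self, one_mul]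
  calc M.nbr d (((M.perm c * M.perm d) ^ i) x)
      = (M.perm d * (M.perm c * M.perm d) ^ i) x := rfl
    _ = M.nbr c (((M.perm c * M.perm d) ^ (i + 1)) x) := by rw [h]; rfl
    _ = _ := by rw [M.nbr_zpow hx, neg_add']

/-- In general an orbit of the rotation need not be a whole Kempe chain, but it is one when a
reflection fixes `x`. Only then is `Linked` closed under both colors. -/
theorem Linked.closed {M : PartialEdgeColoring G C} {c d : C} {x u : V}
    (hx : M.nbr c x = x ∨ M.nbr d x = x) (h : M.Linked c d x u) :
    M.Linked c d x (M.nbr c u) ∧ M.Linked c d x (M.nbr d u) := by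
  rcases hx with hx | hx
  · obtain ⟨i, rfl⟩ := h
    exact ⟨⟨-i, (M.nbr_zpow hx i).symm⟩, ⟨-i - 1, (M.nbr_zpow' hx i).symm⟩⟩
  · rw [linked_comm] at h
    rw [linked_comm, M.linked_comm (c := c)]
    obtain ⟨i, rfl⟩ := h
    exact ⟨⟨-i - 1, (M.nbr_zpow' hx i).symm⟩, ⟨-i, (M.nbr_zpow hx i).symm⟩⟩

/-- A Kempe chain has only two ends. -/
theorem Linked.eq_of_missing {M : PartialEdgeColoring G C} {c d : C} {x u v : V}
    (hx : M.nbr c x = x) (hu : M.nbr d u = u) (hv : M.nbr d v = v)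
    (hxu : M.Linked c d x u) (hxv : M.Linked c d x v) : u = v := by
  obtain ⟨i, rfl⟩ := hxu
  obtain ⟨j, rfl⟩ := hxv
  rw [M.nbr_zpow' hx] at hu hv
  set r := M.perm c * M.perm d
  have key : ∀ p q : ℤ, (r ^ p) x = (r ^ q) x → ∀ k : ℤ, (r ^ ((q - p) * k)) x = x := by
    intro p q h k
    rw [zpow_mul]
    refine Equiv.Perm.zpow_apply_eq_self_of_apply_eq_self ?_ k
    rw [sub_eq_neg_add, zpow_add, Equiv.Perm.mul_apply, ← h, ← Equiv.Perm.mul_apply, ← zpow_add]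
    simp
  -- That `d` is missing at `r ^ i x` and at `r ^ j x` says that `2i + 1` and `2j + 1` are periods
  -- of `x`. Their combination `(2i + 1)(-j) + (2j + 1)i = i - j` is then a period too.
  have hp := key _ _ hu
  have hq := key _ _ hv
  have : (r ^ (i - j)) x = x := by
    have e : i - j = (i - (-i - 1)) * (-j) + (j - (-j - 1)) * i := by ring
    rw [e, zpow_add, Equiv.Perm.mul_apply, hq, hp]
  calc (r ^ i) x = (r ^ (j + (i - j))) x := by congr 2; ring
    _ = (r ^ j) x := by rw [zpow_add, Equiv.Perm.mul_apply, this]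

end PartialEdgeColoring
end SimpleGraph

namespace SimpleGraph
namespace PartialEdgeColoring

open scoped Classical

variable {V : Type*} {G : SimpleGraph V} {C : Type*}

/-! ### Fans -/

/-- `w` can follow `u` in a fan at `x`: the color of `xw` is missing at `u`. -/
def FanStep (M : PartialEdgeColoring G C) (x u w : V) : Prop :=
  ∃ c, M.nbr c u = u ∧ M.nbr c x = w ∧ w ≠ x

/-- `u` is a member of a fan at `x` that starts with the edge `xy`. -/
def FanReach (M : PartialEdgeColoring G C) (x y u : V) : Prop :=
  ∃ l : List V, (y :: l).IsChain (M.FanStep x) ∧ (y :: l).Nodup ∧ (y :: l).getLast (by simp) = u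

theorem FanReach.refl (M : PartialEdgeColoring G C) (x y : V) : M.FanReach x y y :=
  ⟨[], by simp⟩

theorem FanReach.prefix {M : PartialEdgeColoring G C} {x y u : V} {l : List V}
    (hc : (y :: l).IsChain (M.FanStep x)) (hn : (y :: l).Nodup) (hu : u ∈ y :: l) :
    ∃ l' : List V, (y :: l').IsChain (M.FanStep x) ∧ (y :: l').Nodup ∧
      (y :: l').getLast (by simp) = u ∧ (y :: l') <+: (y :: l) := by
  obtain ⟨s, t, hst⟩ := List.append_of_mem hu
  cases s with
  | nil =>
    simp only [List.nil_append, List.cons.injEq] at hst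
    exact ⟨[], by simp, by simp, by simp [hst.1], by simp⟩
  | cons a s =>
    simp only [List.cons_append, List.cons.injEq] at hst
    obtain ⟨rfl, rfl⟩ := hst
    have hp : (y :: (s ++ [u])) <+: (y :: (s ++ u :: t)) := ⟨t, by simp⟩
    exact ⟨s ++ [u], hc.prefix hp, hn.sublist hp.sublist, by simp, hp⟩

/-- If `w` already occurs, the fan is cut off there. So the requirement of distinct vertices does
not restrict which vertices are reachable. -/
theorem FanReach.step {M : PartialEdgeColoring G C} {x y u w : V} (h : M.FanReach x y u)
    (hs : M.FanStep x u w) : M.FanReach x y w := by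
  obtain ⟨l, hc, hn, rfl⟩ := h
  by_cases hw : w ∈ y :: l
  · obtain ⟨l', h1, h2, h3, -⟩ := FanReach.prefix hc hn hw
    exact ⟨l', h1, h2, h3⟩
  · refine ⟨l ++ [w], ?_, ?_, by simp⟩
    · rw [← List.cons_append, List.isChain_append]
      refine ⟨hc, by simp, ?_⟩
      intro a ha b hb
      rw [List.getLast?_eq_getLast_of_ne_nil (by simp)] at ha
      simp only [Option.mem_def, Option.some.injEq, List.head?_cons] at ha hb
      rw [← ha, ← hb]
      exact hs
    · rw [← List.cons_append, List.nodup_append]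
      refine ⟨hn, by simp, ?_⟩
      intro a ha b hb
      simp only [List.mem_singleton] at hb
      rintro rfl
      exact hw (hb ▸ ha)

theorem FanReach.exists_step {M : PartialEdgeColoring G C} {x y w : V} (h : M.FanReach x y w)
    (hw : w ≠ y) : ∃ u, M.FanReach x y u ∧ M.FanStep x u w := by
  obtain ⟨l, hc, hn, rfl⟩ := h
  rcases List.eq_nil_or_concat' l with rfl | ⟨s, a, rfl⟩
  · simp at hw
  · rw [← List.cons_append] at hc hn
    refine ⟨(y :: s).getLast (by simp), ⟨s, (List.isChain_append.1 hc).1,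
      hn.sublist (List.sublist_append_left _ _), rfl⟩, ?_⟩
    refine (List.isChain_append.1 hc).2.2 _ ?_ _ ?_
    · rw [List.getLast?_eq_getLast_of_ne_nil (by simp)]
      rfl
    · simp

theorem FanReach.trans {M : PartialEdgeColoring G C} {x y z u : V} (h : M.FanReach x y z)
    (h' : M.FanReach x z u) : M.FanReach x y u := by
  obtain ⟨l, hc, -, rfl⟩ := h'
  induction l generalizing z with
  | nil => simpa using h
  | cons a l ih =>
    rw [List.isChain_cons_cons] at hc
    simpa using ih (h.step hc.1) hc.2

theorem FanReach.adj {M : PartialEdgeColoring G C} {x y u : V} (h : M.FanReach x y u)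
    (hy : G.Adj x y) : G.Adj x u := by
  by_cases hu : u = y
  · exact hu ▸ hy
  · obtain ⟨_, -, c, -, rfl, hne⟩ := h.exists_step hu
    exact M.adj c x hne

/-! ### Colorings in which every color class is large -/

variable [Fintype V]

/-- In every proper edge coloring with colors in `C`, each color is missing at no more than two
vertices. -/
def AllClassesLarge (G : SimpleGraph V) (C : Type*) : Prop :=
  ∀ M : PartialEdgeColoring G C, M.IsTotal → ∀ c, (M.missingAt c).card ≤ 2

/-- Vizing's shift: `xy` is the only edge that may be uncolored. Colors move along the fan towards
`y` until the uncolored edge can take `d`. The color `c` is never used, so the resulting total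
coloring still has too small a class. -/
theorem AllClassesLarge.not_common_missing_aux (H : AllClassesLarge G C) {x : V} {c d : C}
    (hdc : d ≠ c) (l : List V) :
    ∀ (M : PartialEdgeColoring G C) (y : V), G.Adj x y → (∀ e, M.nbr e x ≠ y) →
      (∀ u v, G.Adj u v → (∃ e, M.nbr e u = v) ∨ s(u, v) = s(x, y)) →
      2 < (M.missingAt c).card → M.nbr c x = x → (y :: l).IsChain (M.FanStep x) →
      (y :: l).Nodup → M.nbr d x = x →
      M.nbr d ((y :: l).getLast (by simp)) = (y :: l).getLast (by simp) → False := by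
  induction l with
  | nil =>
    intro M y hadj hxy hunc hcard hcx _ _ hdx hdy
    simp only [List.getLast_singleton] at hdy
    have hN : (M.recolor d x y hadj hdy hxy).IsTotal := by
      intro u v huv
      rcases hunc u v huv with ⟨e, he⟩ | h
      · refine ⟨e, ?_⟩
        by_cases hed : e = d
        · subst hed
          rw [recolor_nbr]
          have := huv.ne
          grind
        · rw [recolor_nbr_of_ne _ _ _ _ hed, he]
      · refine ⟨d, ?_⟩
        rw [recolor_nbr]
        have := hadj.ne
        rcases Sym2.eq_iff.1 h with ⟨rfl, rfl⟩ | ⟨rfl, rfl⟩ <;> grind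
    refine absurd (H _ hN c) (not_le.2 ?_)
    simpa [missingAt, recolor_nbr_of_ne _ _ _ _ hdc.symm] using hcard
  | cons w l ih =>
    intro M y hadj hxy hunc hcard hcx hch hnd hdx hdl
    rw [List.isChain_cons_cons] at hch
    obtain ⟨⟨b, hby, hbx, hwx⟩, hch⟩ := hch
    have hcb : c ≠ b := by rintro rfl; exact hwx (hbx ▸ hcx)
    have hdb : d ≠ b := by rintro rfl; exact hwx (hbx ▸ hdx)
    have hyw : y ≠ w := by rintro rfl; simp at hnd
    have hynot : y ∉ w :: l := (List.nodup_cons.1 hnd).1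
    have hnd' := (List.nodup_cons.1 hnd).2
    have hwnot : w ∉ l := (List.nodup_cons.1 hnd').1
    have hne := hadj.ne
    -- The color `b` moves from `xw` to `xy`; now `xw` is uncolored and the tail is a fan for it.
    refine ih (M.recolor b x y hadj hby hxy) w (hbx ▸ M.adj b x (hbx ▸ hwx)) ?_ ?_ ?_ ?_ ?_ hnd'
      ?_ ?_
    · intro e he
      by_cases heb : e = b
      · subst heb
        rw [recolor_nbr, if_pos rfl] at he
        exact hyw he
      · rw [recolor_nbr_of_ne _ _ _ _ heb] at he
        exact heb (M.inj e b x (he ▸ hwx) (he.trans hbx.symm))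
    · intro u v huv
      rcases hunc u v huv with ⟨e, he⟩ | h
      · by_cases heb : e = b
        · subst heb
          by_cases hux : u = x
          · right; rw [← he, hux, hbx]
          · by_cases huw : u = w
            · right
              rw [← he, huw, ← hbx, M.invol, Sym2.eq_swap]
            · left
              refine ⟨e, ?_⟩
              rw [recolor_nbr]
              have := huv.ne
              grind
        · left
          exact ⟨e, by rw [recolor_nbr_of_ne _ _ _ _ heb, he]⟩
      · left
        refine ⟨b, ?_⟩
        rw [recolor_nbr]
        rcases Sym2.eq_iff.1 h with ⟨rfl, rfl⟩ | ⟨rfl, rfl⟩ <;> grind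
    · simpa [missingAt, recolor_nbr_of_ne _ _ _ _ hcb] using hcard
    · rw [recolor_nbr_of_ne _ _ _ _ hcb, hcx]
    · refine hch.imp_of_mem_tail_imp fun u v hu hv => ?_
      rintro ⟨e, h1, h2, h3⟩
      -- A later step of color `b` would lead to `w` again, against distinctness.
      have heb : e ≠ b := by
        rintro rfl
        exact hwnot (by simpa [← h2, hbx] using hv)
      exact ⟨e, by rw [recolor_nbr_of_ne _ _ _ _ heb, h1],
        by rw [recolor_nbr_of_ne _ _ _ _ heb, h2], h3⟩
    · rw [recolor_nbr_of_ne _ _ _ _ hdb, hdx]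
    · rw [recolor_nbr_of_ne _ _ _ _ hdb]
      simpa using hdl

/-! ### Fans and Kempe changes in a coloring with large classes. -/

section Fan

variable {M : PartialEdgeColoring G C} {c : C} {x y : V}

/-- Uncoloring `xy` makes `c` missing at `x` as well, hence at more than two vertices, and the shift
along the fan gives the contradiction. -/
theorem AllClassesLarge.not_common_missing (H : AllClassesLarge G C) (hM : M.IsTotal)
    (hc : (M.missingAt c).card = 2) (hy : M.nbr c x = y) (hyx : y ≠ x) {u : V}
    (hu : M.FanReach x y u) {d : C} (hdx : M.nbr d x = x) : M.nbr d u ≠ u := by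
  intro hdu
  obtain ⟨l, hch, hnd, rfl⟩ := hu
  have hdc : d ≠ c := by rintro rfl; exact hyx (hy ▸ hdx)
  have hadj : G.Adj x y := hy ▸ M.adj c x (hy ▸ hyx)
  have hynot := (List.nodup_cons.1 hnd).1
  refine H.not_common_missing_aux hdc l (M.uncolor c x) y hadj ?_ ?_ ?_ ?_ ?_ hnd ?_ ?_
  · intro e he
    by_cases hec : e = c
    · subst hec
      rw [uncolor_nbr, if_pos (Or.inl rfl)] at he
      exact hyx he.symm
    · rw [uncolor_nbr_of_ne _ _ hec] at he
      exact hec (M.inj e c x (he ▸ hyx) (he.trans hy.symm))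
  · intro u v huv
    obtain ⟨e, he⟩ := hM u v huv
    by_cases hec : e = c
    · subst hec
      by_cases hux : u = x
      · right; rw [← he, hux, hy]
      · by_cases huy : u = y
        · right; rw [← he, huy, ← hy, M.invol, Sym2.eq_swap]
        · left
          refine ⟨e, ?_⟩
          rw [uncolor_nbr, if_neg (by rw [hy]; tauto), he]
    · exact Or.inl ⟨e, by rw [uncolor_nbr_of_ne _ _ hec, he]⟩
  · rw [← hc]
    refine Finset.card_lt_card ?_
    rw [Finset.ssubset_iff]
    refine ⟨x, by simpa using (hy ▸ hyx), ?_⟩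
    intro v hv
    rcases Finset.mem_insert.1 hv with rfl | hv
    · simp [uncolor_nbr]
    · rw [mem_missingAt] at hv
      simp [uncolor_nbr, hv]
  · simp [uncolor_nbr]
  · refine hch.imp_of_mem_tail_imp fun u v hu hv => ?_
    rintro ⟨e, h1, h2, h3⟩
    have hec : e ≠ c := by
      rintro rfl
      exact hynot (by simpa [← h2, hy] using hv)
    exact ⟨e, by rw [uncolor_nbr_of_ne _ _ hec, h1], by rw [uncolor_nbr_of_ne _ _ hec, h2], h3⟩
  · rw [uncolor_nbr_of_ne _ _ hdc, hdx]
  · rw [uncolor_nbr_of_ne _ _ hdc, hdu]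

/-- Exchanging `a` and `b` on `K` makes `a` missing at both `x` and `v`. The fan survives: its other
vertices that miss `b`, and `x` itself, lie outside `K`. The color `c` is untouched because it
differs from `a` and `b`. -/
theorem AllClassesLarge.false_of_closed (H : AllClassesLarge G C) (hM : M.IsTotal)
    (hc : (M.missingAt c).card = 2) (hy : M.nbr c x = y) (hyx : y ≠ x) {l : List V}
    (hch : (y :: l).IsChain (M.FanStep x)) (hnd : (y :: l).Nodup) {v : V}
    (hv : (y :: l).getLast (by simp) = v) {a b : C} (hbc : b ≠ c) (hax : M.nbr a x = x)
    (hbv : M.nbr b v = v) (K : Set V) (hK : ∀ v ∈ K, M.nbr a v ∈ K ∧ M.nbr b v ∈ K)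
    (hvK : v ∈ K) (hxK : x ∉ K) (hl : ∀ p ∈ y :: l, p ≠ v → M.nbr b p = p → p ∉ K) : False := by
  have hac : c ≠ a := by rintro rfl; exact hyx (hy ▸ hax)
  have hcN : (M.kempeSwap a b K hK).nbr c = M.nbr c := kempeSwap_nbr_of_ne hac hbc.symm
  refine H.not_common_missing (M := M.kempeSwap a b K hK) hM.kempeSwap (c := c) (x := x) (y := y)
    (u := v) (d := a) ?_ ?_ hyx ⟨l, ?_, hnd, hv⟩ ?_ ?_
  · simpa [missingAt, hcN] using hc
  · rw [hcN, hy]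
  -- Only the end of the fan is `v`, so no step leaves from `v`; that the exchange spoils `b` at `v`
  -- does no harm.
  · have hlast : ∀ s : List V, s.Nodup → ∀ h : s ≠ [], (s.getLast h = v) →
        s.IsChain (M.FanStep x) → s.IsChain (fun p q => M.FanStep x p q ∧ p ≠ v) := by
      intro s
      induction s with
      | nil => simp
      | cons p s ih =>
        intro hs _ hp hc
        cases s with
        | nil => simp
        | cons q s =>
          rw [List.isChain_cons_cons] at hc ⊢
          refine ⟨⟨hc.1, ?_⟩, ih (List.nodup_cons.1 hs).2 (by simp) (by simpa using hp) hc.2⟩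
          rintro rfl
          refine (List.nodup_cons.1 hs).1 ?_
          rw [List.getLast_cons (by simp)] at hp
          rw [← hp]
          exact List.getLast_mem _
    refine (hlast _ hnd (by simp) hv hch).imp_of_mem_imp fun p q hp hq => ?_
    rintro ⟨⟨e, h1, h2, h3⟩, hpv⟩
    have hea : e ≠ a := by rintro rfl; exact h3 (h2 ▸ hax)
    refine ⟨e, ?_, by rw [kempeSwap_nbr_of_notMem hxK, h2], h3⟩
    by_cases heb : e = b
    · subst heb
      rw [kempeSwap_nbr_of_notMem (hl p hp hpv h1), h1]
    · rw [kempeSwap_nbr_of_ne hea heb, h1]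
  · rw [kempeSwap_nbr_of_notMem hxK, hax]
  · rw [kempeSwap_nbr_of_mem hvK, Equiv.swap_apply_left, hbv]

/-- On a fan, the first vertex that misses `b` ends the Kempe chain that starts at `x`. -/
theorem AllClassesLarge.exists_linked (H : AllClassesLarge G C) (hM : M.IsTotal)
    (hc : (M.missingAt c).card = 2) (hy : M.nbr c x = y) (hyx : y ≠ x) {l : List V}
    (hch : (y :: l).IsChain (M.FanStep x)) (hnd : (y :: l).Nodup) {v : V}
    (hv : v ∈ y :: l) {a b : C} (hbc : b ≠ c) (hax : M.nbr a x = x)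
    (hbv : M.nbr b v = v) : ∃ u ∈ y :: l, M.nbr b u = u ∧ M.Linked a b x u := by
  induction hn : l.length using Nat.strong_induction_on generalizing l v with
  | _ n ih =>
    obtain ⟨l', h1, h2, h3, h4⟩ := FanReach.prefix hch hnd hv
    -- Pass to the first vertex of the fan that misses `b`; before it nothing can be spoiled by an
    -- exchange on its chain.
    by_cases h : ∃ p ∈ y :: l', p ≠ v ∧ M.nbr b p = p
    · obtain ⟨p, hp, hpv, hbp⟩ := h
      obtain ⟨l'', g1, g2, g3, g4⟩ := FanReach.prefix h1 h2 hp
      have hlt : l''.length < n := by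
        have e1 := g4.length_le
        have e2 := h4.length_le
        simp only [List.length_cons] at e1 e2
        refine lt_of_le_of_ne (by omega) fun e => ?_
        have := g4.eq_of_length (by simp only [List.length_cons]; omega)
        simp only [this] at g3
        exact hpv (g3.symm.trans h3)
      obtain ⟨u, hu, hu'⟩ := ih _ hlt g1 g2 (v := p) (g3 ▸ List.getLast_mem _) hbp rfl
      exact ⟨u, h4.subset (g4.subset hu), hu'⟩
    · push Not at h
      refine ⟨v, hv, hbv, ?_⟩
      by_contra hlink
      refine H.false_of_closed hM hc hy hyx h1 h2 h3 hbc hax hbv {u | M.Linked a b v u}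
        (fun u hu => hu.closed (Or.inr hbv)) (Linked.refl _ _ _ _) (fun h => hlink h.symm)
        (fun p hp hpv hbp => absurd hbp (h p hp hpv))

/-- Two vertices of a fan have no missing color in common. -/
theorem AllClassesLarge.fan_elementary (H : AllClassesLarge G C) (hM : M.IsTotal)
    (hc : (M.missingAt c).card = 2) (hy : M.nbr c x = y) (hyx : y ≠ x) {u v : V}
    (hu : M.FanReach x y u) (hv : M.FanReach x y v) {a b : C} (hbc : b ≠ c)
    (hax : M.nbr a x = x) (hbu : M.nbr b u = u) (hbv : M.nbr b v = v) : u = v := by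
  have huniq : ∀ {p q}, M.nbr b p = p → M.nbr b q = q → M.Linked a b x p → M.Linked a b x q →
      p = q := fun hp hq h h' => h.eq_of_missing hax hp hq h'
  -- any vertex of the fan that misses `b` is linked to `x`
  suffices key : ∀ {v}, M.FanReach x y v → M.nbr b v = v → M.Linked a b x v from
    huniq hbu hbv (key hu hbu) (key hv hbv)
  clear hu hv hbu hbv u v
  intro v hv hbv
  by_contra hlink
  obtain ⟨l, hch, hnd, hl⟩ := hv
  obtain ⟨u, hu, hbu, hul⟩ := H.exists_linked hM hc hy hyx hch hnd (v := v)
    (hl ▸ List.getLast_mem _) hbc hax hbv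
  have huv : u ≠ v := by rintro rfl; exact hlink hul
  refine H.false_of_closed hM hc hy hyx hch hnd hl hbc hax hbv {u | M.Linked a b v u}
    (fun u hu => hu.closed (Or.inr hbv)) (Linked.refl _ _ _ _) (fun h => hlink h.symm) ?_
  -- An obstructing `p` on the chain of `v` would be a third vertex missing `b`, besides `v` and the
  -- end `u` of the chain from `x`.
  intro p _ hpv hbp hp
  have hpu : p ≠ u := by
    rintro rfl
    exact hlink (hul.trans (Linked.symm hp))
  have h3 : ({p, u, v} : Finset V).card = 3 := by
    rw [Finset.card_eq_three]
    exact ⟨p, u, v, hpu, hpv, huv, rfl⟩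
  have hsub : ({p, u, v} : Finset V) ⊆ M.missingAt b := by
    intro w hw
    simp only [Finset.mem_insert, Finset.mem_singleton] at hw
    rcases hw with rfl | rfl | rfl <;> simpa
  have := Finset.card_le_card hsub
  have := H M hM b
  omega

theorem AllClassesLarge.linked_of_fanReach (H : AllClassesLarge G C) (hM : M.IsTotal)
    (hc : (M.missingAt c).card = 2) (hy : M.nbr c x = y) (hyx : y ≠ x) {v : V}
    (hv : M.FanReach x y v) {a b : C} (hbc : b ≠ c) (hax : M.nbr a x = x)
    (hbv : M.nbr b v = v) : M.Linked a b x v := by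
  obtain ⟨l, hch, hnd, hl⟩ := hv
  have hvm : v ∈ y :: l := hl ▸ List.getLast_mem _
  obtain ⟨u, hu, hbu, hul⟩ := H.exists_linked hM hc hy hyx hch hnd hvm hbc hax hbv
  obtain ⟨l', h1, h2, h3, -⟩ := FanReach.prefix hch hnd hu
  rwa [← H.fan_elementary hM hc hy hyx ⟨l', h1, h2, h3⟩ ⟨l, hch, hnd, hl⟩ hbc hax hbu hbv]

end Fan

end PartialEdgeColoring
end SimpleGraph

namespace SimpleGraph
namespace PartialEdgeColoring

open scoped Classical

variable {V : Type*} {G : SimpleGraph V} {C : Type*}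

/-! ### Counting missing colors on a fan -/

section Missing

variable [Fintype C]

/-- The colors missing at `v`. -/
noncomputable def missing (M : PartialEdgeColoring G C) (v : V) : Finset C :=
  {c | M.nbr c v = v}

@[simp] theorem mem_missing {M : PartialEdgeColoring G C} {c : C} {v : V} :
    c ∈ M.missing v ↔ M.nbr c v = v := by simp [missing]

theorem IsTotal.card_missing_add_degree [Fintype V] [DecidableRel G.Adj]
    {M : PartialEdgeColoring G C} (hM : M.IsTotal) (v : V) :
    (M.missing v).card + G.degree v = Fintype.card C := by
  rw [← hM.card_covering_eq_degree]
  exact Finset.card_filter_add_card_filter_not (s := Finset.univ) (fun c => M.nbr c v = v)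

theorem sum_card_missing [Fintype V] (M : PartialEdgeColoring G C) :
    ∑ v, (M.missing v).card = ∑ c, (M.missingAt c).card := by
  simp_rw [missing, missingAt, Finset.card_filter]
  exact Finset.sum_comm

end Missing

variable [Fintype V]

theorem AllClassesLarge.card_missingAt_eq_two (H : AllClassesLarge G C)
    (hV : Even (Fintype.card V)) {M : PartialEdgeColoring G C} (hM : M.IsTotal) {c : C} {v : V}
    (hv : M.nbr c v = v) : (M.missingAt c).card = 2 := by
  have h1 := H M hM c
  have h2 := M.even_card_missingAt hV c
  have h3 : 0 < (M.missingAt c).card := Finset.card_pos.2 ⟨v, by simpa⟩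
  obtain ⟨k, hk⟩ := h2
  omega

section Fan

variable [Fintype C] {M : PartialEdgeColoring G C} {c : C} {x y : V}

/-- The vertices of the fans at `x` that start with `xy`. -/
noncomputable def fan (M : PartialEdgeColoring G C) (x y : V) : Finset V :=
  {u | M.FanReach x y u}

omit [Fintype C] in
@[simp] theorem mem_fan {u : V} : u ∈ M.fan x y ↔ M.FanReach x y u := by simp [fan]

/-- Each color other than `c` missing on the fan is present at `x` and leads to a fan vertex other
than `y`; each such vertex arises once. Elementarity makes the sets of missing colors disjoint. -/
theorem AllClassesLarge.sum_card_missing_fan (H : AllClassesLarge G C) (hM : M.IsTotal)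
    (hne : ∀ v, ∃ c, M.nbr c v = v)
    (hc : (M.missingAt c).card = 2) (hy : M.nbr c x = y) (hyx : y ≠ x) :
    ∑ u ∈ M.fan x y, ((M.missing u).erase c).card + 1 = (M.fan x y).card := by
  obtain ⟨a, hax⟩ := hne x
  have hdisj : (M.fan x y : Set V).PairwiseDisjoint fun u => (M.missing u).erase c := by
    intro u hu v hv huv
    rw [Function.onFun, Finset.disjoint_left]
    intro b hb hb'
    simp only [Finset.mem_erase, mem_missing] at hb hb'
    exact huv (H.fan_elementary hM hc hy hyx (mem_fan.1 hu) (mem_fan.1 hv) hb.1 hax hb.2 hb'.2)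
  have hyS : y ∈ M.fan x y := mem_fan.2 (FanReach.refl M x y)
  have hcov : ∀ {b u}, u ∈ M.fan x y → M.nbr b u = u → M.nbr b x ≠ x := by
    intro b u hu hb hbx
    exact H.not_common_missing hM hc hy hyx (mem_fan.1 hu) hbx hb
  rw [← Finset.card_biUnion hdisj, ← Finset.card_erase_add_one hyS, Nat.add_right_cancel_iff]
  refine Finset.card_bij (fun b _ => M.nbr b x) ?_ ?_ ?_
  · intro b hb
    simp only [Finset.mem_biUnion, Finset.mem_erase, mem_missing] at hb
    obtain ⟨u, hu, hbc, hbu⟩ := hb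
    have hbx := hcov hu hbu
    refine Finset.mem_erase.2 ⟨fun h => hbc (M.inj b c x hbx (h.trans hy.symm)), ?_⟩
    exact mem_fan.2 ((mem_fan.1 hu).step ⟨b, hbu, rfl, hbx⟩)
  · intro b hb d _ h
    simp only [Finset.mem_biUnion, Finset.mem_erase, mem_missing] at hb
    obtain ⟨u, hu, -, hbu⟩ := hb
    exact M.inj b d x (hcov hu hbu) h
  · intro w hw
    obtain ⟨hwy, hw⟩ := Finset.mem_erase.1 hw
    obtain ⟨u, hu, b, hbu, hbx, -⟩ := (mem_fan.1 hw).exists_step hwy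
    refine ⟨b, ?_, hbx⟩
    simp only [Finset.mem_biUnion, Finset.mem_erase, mem_missing]
    exact ⟨u, mem_fan.2 hu, by rintro rfl; exact hwy (hbx ▸ hy), hbu⟩

/-- The excesses of missing colors on a fan add up to at most `1`. -/
theorem AllClassesLarge.sum_excess_fan (H : AllClassesLarge G C) (hM : M.IsTotal)
    (hne : ∀ v, ∃ c, M.nbr c v = v)
    (hc : (M.missingAt c).card = 2) (hy : M.nbr c x = y) (hyx : y ≠ x) :
    ∑ u ∈ M.fan x y, ((M.missing u).card - 1) + 1 = (M.fan x y ∩ M.missingAt c).card := by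
  have h1 := H.sum_card_missing_fan hM hne hc hy hyx
  have h2 : ∀ u ∈ M.fan x y, ((M.missing u).card - 1) + 1 =
      ((M.missing u).erase c).card + if u ∈ M.missingAt c then 1 else 0 := by
    intro u _
    have hpos : 0 < (M.missing u).card := by
      obtain ⟨d, hd⟩ := hne u
      exact Finset.card_pos.2 ⟨d, by simpa⟩
    split_ifs with h
    · rw [Finset.card_erase_add_one (by simpa using h)]
      omega
    · rw [Finset.erase_eq_of_notMem (by simpa using h)]
      omega
  have h3 := Finset.sum_congr rfl h2
  rw [Finset.sum_add_distrib, Finset.sum_add_distrib, ← Finset.card_filter,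
    Finset.filter_mem_eq_inter, Finset.sum_const, smul_eq_mul, mul_one] at h3
  omega

theorem AllClassesLarge.exists_missingAt_fan (H : AllClassesLarge G C) (hM : M.IsTotal)
    (hne : ∀ v, ∃ c, M.nbr c v = v)
    (hc : (M.missingAt c).card = 2) (hy : M.nbr c x = y) (hyx : y ≠ x) :
    ∃ a, M.nbr c a = a ∧ M.FanReach x y a := by
  have h := H.sum_excess_fan hM hne hc hy hyx
  obtain ⟨a, ha⟩ := Finset.card_pos.1 (Nat.lt_of_lt_of_eq (Nat.succ_pos _) h)
  simp only [Finset.mem_inter, mem_fan, mem_missingAt] at ha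
  exact ⟨a, ha.2, ha.1⟩

/-- The fan starting with the edge of color `c` at `x` contains `a` or `b`, and all fan vertices are
neighbors of `x`. -/
theorem AllClassesLarge.adj_or_adj (H : AllClassesLarge G C) (hV : Even (Fintype.card V))
    (hM : M.IsTotal) (hne : ∀ v, ∃ c, M.nbr c v = v) {a b : V} (ha : M.nbr c a = a)
    (hb : M.nbr c b = b) (hab : a ≠ b) (hxa : x ≠ a) (hxb : x ≠ b) :
    G.Adj x a ∨ G.Adj x b := by
  have hc := H.card_missingAt_eq_two hV hM ha
  have heq : ∀ {v}, M.nbr c v = v → v = a ∨ v = b := by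
    have hsub : ({a, b} : Finset V) ⊆ M.missingAt c := by
      intro v hv
      simp only [Finset.mem_insert, Finset.mem_singleton] at hv
      rcases hv with rfl | rfl <;> simpa
    have := Finset.eq_of_subset_of_card_le hsub (by rw [hc, Finset.card_pair hab])
    intro v hv
    rw [← mem_missingAt, ← this] at hv
    simpa using hv
  have hx : M.nbr c x ≠ x := by
    intro h
    rcases heq h with h | h
    · exact hxa h
    · exact hxb h
  obtain ⟨v, hv, hr⟩ := H.exists_missingAt_fan hM hne hc rfl hx
  have hadj := hr.adj (M.adj c x hx)
  rcases heq hv with rfl | rfl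
  · exact Or.inl hadj
  · exact Or.inr hadj

/-- Use the fan at the other end of the edge of color `c` at `y`. The total excess is at most `1`;
if `y` uses it up, both vertices missing `c` are in the fan and have none. -/
theorem AllClassesLarge.card_missing_le_two (H : AllClassesLarge G C) (hM : M.IsTotal)
    (hne : ∀ v, ∃ c, M.nbr c v = v)
    (hc : (M.missingAt c).card = 2) (hy : M.nbr c y ≠ y) :
    (M.missing y).card ≤ 2 ∧
      ((M.missing y).card = 2 → ∀ a, M.nbr c a = a → (M.missing a).card ≤ 1) := by
  have hyx : y ≠ M.nbr c y := hy.symm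
  have h := H.sum_excess_fan hM hne hc (M.invol c y) hyx
  have hle : (M.fan (M.nbr c y) y ∩ M.missingAt c).card ≤ 2 :=
    hc ▸ Finset.card_le_card Finset.inter_subset_right
  have hyS : y ∈ M.fan (M.nbr c y) y := mem_fan.2 (FanReach.refl M _ y)
  have h1 := Finset.single_le_sum (f := fun u => (M.missing u).card - 1) (fun _ _ => Nat.zero_le _)
    hyS
  refine ⟨by omega, fun h2 a ha => ?_⟩
  have heq : M.fan (M.nbr c y) y ∩ M.missingAt c = M.missingAt c :=
    Finset.eq_of_subset_of_card_le Finset.inter_subset_right (by omega)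
  have haS : a ∈ M.fan (M.nbr c y) y :=
    (Finset.mem_inter.1 (heq ▸ mem_missingAt.2 ha : a ∈ _ ∩ _)).1
  have hya : y ≠ a := by rintro rfl; exact hy ha
  have h3 := Finset.sum_le_sum_of_subset (f := fun u => (M.missing u).card - 1)
    (Finset.insert_subset hyS (Finset.singleton_subset_iff.2 haS))
  rw [Finset.sum_pair hya] at h3
  omega

/-- If both had positive excess, the excess on a fan would be at least the number of its vertices
missing `c`, whereas it is one less. -/
theorem AllClassesLarge.card_missing_le_one_or (H : AllClassesLarge G C)
    (hV : 2 < Fintype.card V) (hM : M.IsTotal)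
    (hne : ∀ v, ∃ c, M.nbr c v = v) {a b : V} (hab : a ≠ b) (ha : M.nbr c a = a)
    (hb : M.nbr c b = b)
    (hc : (M.missingAt c).card = 2) : (M.missing a).card ≤ 1 ∨ (M.missing b).card ≤ 1 := by
  obtain ⟨x, -, hx⟩ := Finset.exists_mem_notMem_of_card_lt_card
    (s := M.missingAt c) (t := Finset.univ) (by rwa [hc, Finset.card_univ])
  rw [mem_missingAt] at hx
  have h := H.sum_excess_fan hM hne hc rfl hx
  have hpair : ({a, b} : Finset V) = M.missingAt c := by
    refine Finset.eq_of_subset_of_card_le ?_ (by rw [hc, Finset.card_pair hab])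
    intro v hv
    simp only [Finset.mem_insert, Finset.mem_singleton] at hv
    rcases hv with rfl | rfl <;> simpa
  have hsum := Finset.sum_le_sum_of_subset (f := fun u => (M.missing u).card - 1)
    (Finset.inter_subset_left (s₁ := M.fan x (M.nbr c x)) (s₂ := M.missingAt c))
  rw [← hpair] at hsum h
  have hle : (M.fan x (M.nbr c x) ∩ {a, b}).card ≤ 2 :=
    Finset.card_pair hab ▸ Finset.card_le_card Finset.inter_subset_right
  by_contra! hcon
  by_cases haS : a ∈ M.fan x (M.nbr c x) <;> by_cases hbS : b ∈ M.fan x (M.nbr c x)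
  · have e : M.fan x (M.nbr c x) ∩ {a, b} = {a, b} := by
      refine Finset.inter_eq_right.2 (Finset.insert_subset haS (Finset.singleton_subset_iff.2 hbS))
    rw [e, Finset.sum_pair hab] at hsum
    omega
  · have e : M.fan x (M.nbr c x) ∩ {a, b} = {a} := by grind
    rw [e, Finset.sum_singleton] at hsum
    rw [e, Finset.card_singleton] at h
    omega
  · have e : M.fan x (M.nbr c x) ∩ {a, b} = {b} := by grind
    rw [e, Finset.sum_singleton] at hsum
    rw [e, Finset.card_singleton] at h
    omega
  · have e : M.fan x (M.nbr c x) ∩ {a, b} = ∅ := by grind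
    rw [e, Finset.card_empty] at h
    omega

/-! ### Graphs that are not regular -/

theorem AllClassesLarge.isolated_of_two_lt_card_missing (H : AllClassesLarge G C)
    (hV : 2 < Fintype.card V) (hV' : Even (Fintype.card V)) (hM : M.IsTotal)
    (hne : ∀ v, ∃ c, M.nbr c v = v) {v : V} (hv : 2 < (M.missing v).card) :
    (∀ u, ¬ G.Adj v u) ∧ ∀ u w, u ≠ v → w ≠ v → u ≠ w → G.Adj u w := by
  -- With so many missing colors, `v` misses every color that is missing anywhere. So the other
  -- vertices miss one color each, and these are distinct.
  have hmiss : ∀ c u, M.nbr c u = u → M.nbr c v = v := by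
    intro c u hu
    by_contra h
    have := (H.card_missing_le_two hM hne (H.card_missingAt_eq_two hV' hM hu) h).1
    omega
  have hone : ∀ u, u ≠ v → (M.missing u).card = 1 := by
    intro u huv
    obtain ⟨c, hc⟩ := hne u
    have h1 : 0 < (M.missing u).card := Finset.card_pos.2 ⟨c, by simpa⟩
    rcases H.card_missing_le_one_or hV hM hne huv hc (hmiss c u hc)
      (H.card_missingAt_eq_two hV' hM hc) with h | h <;> omega
  have hcard : Fintype.card V - 1 ≤ (M.missing v).card := by
    choose f hf using hne
    rw [← Finset.card_univ, ← Finset.card_erase_of_mem (Finset.mem_univ v)]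
    refine Finset.card_le_card_of_injOn f (fun u _ => by simpa using hmiss _ u (hf u)) ?_
    intro u hu w hw huw
    by_contra hne'
    simp only [Finset.coe_erase, Set.mem_sdiff, Set.mem_singleton_iff] at hu hw
    have h3 : ({u, v, w} : Finset V).card = 3 := Finset.card_eq_three.2
      ⟨u, v, w, hu.2, hne', Ne.symm hw.2, rfl⟩
    have h4 := H M hM (f u)
    have h5 : ({u, v, w} : Finset V) ⊆ M.missingAt (f u) := by
      intro z hz
      simp only [Finset.mem_insert, Finset.mem_singleton] at hz
      rw [mem_missingAt]
      rcases hz with rfl | rfl | rfl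
      · exact hf _
      · exact hmiss _ u (hf u)
      · exact huw ▸ hf _
    have := Finset.card_le_card h5
    omega
  -- A neighbor of `v` would give at least `n` colors, as `v` misses `n - 1` or more. Every other
  -- vertex then has degree `n - 1`, so `v` does too, and the number of colors would be at least
  -- `2(n - 1) > n`.
  have hiso : ∀ u, ¬ G.Adj v u := by
    intro u hu
    have hall : ∀ w, w ≠ v → G.degree w = Fintype.card V - 1 ∧
        Fintype.card C ≤ Fintype.card V := by
      intro w hw
      have h1 := hM.card_missing_add_degree v
      have h2 := hM.card_missing_add_degree w
      have h3 := hone w hw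
      have h4 : 0 < G.degree v := G.degree_pos_iff_exists_adj v |>.2 ⟨u, hu⟩
      have h5 := G.degree_lt_card_verts w
      omega
    have hdv : G.degree v = Fintype.card V - 1 := by
      rw [← G.card_neighborFinset_eq_degree, ← Finset.card_univ,
        ← Finset.card_erase_of_mem (Finset.mem_univ v)]
      congr 1
      ext w
      simp only [mem_neighborFinset, Finset.mem_erase, Finset.mem_univ, and_true]
      refine ⟨fun h => h.ne', fun h => ?_⟩
      have h1 := (hall w h).1
      rw [← G.card_neighborFinset_eq_degree, ← Finset.card_univ,
        ← Finset.card_erase_of_mem (Finset.mem_univ w)] at h1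
      have h2 := Finset.eq_of_subset_of_card_le (s := G.neighborFinset w)
        (t := Finset.univ.erase w) (fun z hz => by
          simpa using (G.ne_of_adj ((G.mem_neighborFinset _ _).1 hz)).symm) h1.ge
      have h3 : v ∈ G.neighborFinset w := by
        rw [h2]
        simpa using h.symm
      exact ((G.mem_neighborFinset _ _).1 h3).symm
    have h1 := hM.card_missing_add_degree v
    have h2 := (hall u hu.ne').2
    omega
  refine ⟨hiso, fun u w hu hw huw => ?_⟩
  obtain ⟨c, hc⟩ := hne u
  rcases H.adj_or_adj hV' hM hne hc (hmiss c u hc) hu huw.symm hw with h | h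
  · exact h.symm
  · exact absurd h.symm (hiso w)

/-- A vertex missing two colors would be the only one, so the missing incidences would number `n +
1`. Counted by colors, their number is even. -/
theorem AllClassesLarge.card_missing_eq_one (H : AllClassesLarge G C)
    (hV : 2 < Fintype.card V) (hV' : Even (Fintype.card V)) (hM : M.IsTotal)
    (hne : ∀ v, ∃ c, M.nbr c v = v) (hle : ∀ v, (M.missing v).card ≤ 2) (v : V) :
    (M.missing v).card = 1 := by
  have hpos : ∀ v, 0 < (M.missing v).card := fun v => by
    obtain ⟨c, hc⟩ := hne v
    exact Finset.card_pos.2 ⟨c, by simpa⟩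
  by_contra hv
  have hv2 : (M.missing v).card = 2 := by
    have := hpos v
    have := hle v
    omega
  have hone : ∀ u ∈ Finset.univ.erase v, (M.missing u).card = 1 := by
    intro u hu
    have huv : u ≠ v := by simpa using hu
    obtain ⟨c, hc⟩ := hne u
    have hc2 := H.card_missingAt_eq_two hV' hM hc
    have := hpos u
    by_cases hcv : M.nbr c v = v
    · rcases H.card_missing_le_one_or hV hM hne huv hc hcv hc2 with h | h <;> omega
    · have := (H.card_missing_le_two hM hne hc2 hcv).2 hv2 u hc
      omega
  have hsum := M.sum_card_missing
  rw [← Finset.add_sum_erase _ _ (Finset.mem_univ v), Finset.sum_congr rfl hone, Finset.sum_const,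
    Finset.card_erase_of_mem (Finset.mem_univ v), Finset.card_univ, hv2, smul_eq_mul,
    mul_one] at hsum
  have heven : Even (∑ c, (M.missingAt c).card) :=
    Finset.even_sum _ fun c _ => M.even_card_missingAt hV' c
  rw [← hsum] at heven
  obtain ⟨k, hk⟩ := hV'
  obtain ⟨j, hj⟩ := heven
  omega

end Fan

end PartialEdgeColoring
end SimpleGraph

namespace SimpleGraph
namespace PartialEdgeColoring

open scoped Classical

variable {V : Type*} {G : SimpleGraph V} {C : Type*}

/-! ### Colorings in which exactly one color is missing at each vertex -/

/-- Adjacency through an edge whose color is missing somewhere. -/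
def DefectAdj (M : PartialEdgeColoring G C) (x w : V) : Prop :=
  w ≠ x ∧ ∃ c u, M.nbr c u = u ∧ M.nbr c x = w

theorem DefectAdj.symm {M : PartialEdgeColoring G C} {x w : V} (h : M.DefectAdj x w) :
    M.DefectAdj w x := by
  obtain ⟨h1, c, u, h2, h3⟩ := h
  exact ⟨h1.symm, c, u, h2, M.nbr_eq_comm.1 h3⟩

theorem DefectAdj.adj {M : PartialEdgeColoring G C} {x w : V} (h : M.DefectAdj x w) :
    G.Adj x w := by
  obtain ⟨h1, c, u, -, rfl⟩ := h
  exact M.adj c x h1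

variable [Fintype V]

section Regular

variable {M : PartialEdgeColoring G C} {f : V → C}

theorem AllClassesLarge.exists_mate (H : AllClassesLarge G C) (hV : Even (Fintype.card V))
    (hM : M.IsTotal) (hf : ∀ c v, M.nbr c v = v ↔ c = f v) (v : V) : ∃ w, w ≠ v ∧ f w = f v := by
  have h := H.card_missingAt_eq_two hV hM ((hf (f v) v).2 rfl)
  obtain ⟨w, hw, hne⟩ := Finset.exists_mem_ne (by omega : 1 < (M.missingAt (f v)).card) v
  exact ⟨w, hne, ((hf _ _).1 (mem_missingAt.1 hw)).symm⟩

theorem AllClassesLarge.eq_or_eq (H : AllClassesLarge G C)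
    (hM : M.IsTotal) (hf : ∀ c v, M.nbr c v = v ↔ c = f v) {a b v : V} (hab : a ≠ b)
    (h : f a = f b) (hv : f v = f a) : v = a ∨ v = b := by
  by_contra! hne
  have h3 : ({a, b, v} : Finset V).card = 3 := Finset.card_eq_three.2
    ⟨a, b, v, hab, hne.1.symm, hne.2.symm, rfl⟩
  have h4 := H M hM (f a)
  have h5 : ({a, b, v} : Finset V) ⊆ M.missingAt (f a) := by
    intro z hz
    simp only [Finset.mem_insert, Finset.mem_singleton] at hz
    rw [mem_missingAt, hf]
    rcases hz with rfl | rfl | rfl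
    · rfl
    · exact h
    · exact hv.symm
  have := Finset.card_le_card h5
  omega

theorem AllClassesLarge.not_defectAdj_of_eq (H : AllClassesLarge G C)
    (hV : Even (Fintype.card V)) (hM : M.IsTotal) (hf : ∀ c v, M.nbr c v = v ↔ c = f v)
    {x w : V} (h : f w = f x) : ¬ M.DefectAdj x w := by
  rintro ⟨hne, c, u, hu, hx⟩
  exact H.not_common_missing hM (H.card_missingAt_eq_two hV hM hu) hx hne (FanReach.refl M x w)
    ((hf (f x) x).2 rfl) ((hf _ _).2 h.symm)

theorem AllClassesLarge.linked_of_defectAdj (H : AllClassesLarge G C)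
    (hV : Even (Fintype.card V)) (hM : M.IsTotal) (hf : ∀ c v, M.nbr c v = v ↔ c = f v)
    {x w : V} (h : M.DefectAdj x w) : M.Linked (f x) (f w) x w := by
  obtain ⟨hne, c, u, hu, hx⟩ := h
  refine H.linked_of_fanReach hM (H.card_missingAt_eq_two hV hM hu) hx hne (FanReach.refl M x w)
    ?_ ((hf _ _).2 rfl) ((hf _ _).2 rfl)
  intro h
  have h1 : M.nbr c w = w := (hf _ _).2 h.symm
  exact hne (h1.symm.trans (M.nbr_eq_comm.1 hx))

/-- The fan starting with the edge of color `f a` at `x` contains `a` or `b`, reached by a step and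
so through a defect edge. For uniqueness, a fan starting with a defect edge to one of the pair can
step along `f a` into the former fan, and elementarity identifies the two vertices missing `f a`. -/
theorem AllClassesLarge.defectAdj_or (H : AllClassesLarge G C)
    (hV : Even (Fintype.card V)) (hM : M.IsTotal) (hf : ∀ c v, M.nbr c v = v ↔ c = f v)
    [Fintype C] {x a b : V} (hab : a ≠ b) (h : f a = f b) (hxa : x ≠ a) (hxb : x ≠ b) :
    (M.DefectAdj x a ∨ M.DefectAdj x b) ∧ ¬ (M.DefectAdj x a ∧ M.DefectAdj x b) := by
  have hx : M.nbr (f a) x ≠ x := by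
    intro hx
    rcases H.eq_or_eq hM hf hab h ((hf _ _).1 hx).symm with h | h
    · exact hxa h
    · exact hxb h
  have hne : ∀ v, ∃ c, M.nbr c v = v := fun v => ⟨f v, (hf _ _).2 rfl⟩
  have hc := H.card_missingAt_eq_two hV hM ((hf (f a) a).2 rfl)
  obtain ⟨v, hv, hr⟩ := H.exists_missingAt_fan hM hne hc rfl hx
  have hya : ∀ {w}, M.nbr (f a) w = w → w ≠ M.nbr (f a) x := by
    rintro _ hw rfl
    rw [M.invol] at hw
    exact hx hw.symm
  have hQ : M.DefectAdj x v := by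
    obtain ⟨u, -, e, heu, hex, hvx⟩ := hr.exists_step (hya hv)
    exact ⟨hvx, e, u, heu, hex⟩
  have hex : ∀ {v d}, M.nbr (f a) v = v → M.nbr (f a) d = d → M.FanReach x (M.nbr (f a) x) v →
      M.DefectAdj x d → d = v := by
    rintro v d hv hd hr ⟨hdx, e, u, heu, hex⟩
    have hstep : M.FanReach x d (M.nbr (f a) x) :=
      (FanReach.refl M x d).step ⟨f a, hd, rfl, hx⟩
    refine H.fan_elementary hM (H.card_missingAt_eq_two hV hM heu) hex hdx (FanReach.refl M x d)
      (hstep.trans hr) (b := f a) ?_ ((hf _ _).2 rfl) hd hv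
    rintro rfl
    exact hya hd hex.symm
  have ha : M.nbr (f a) a = a := (hf _ _).2 rfl
  have hb : M.nbr (f a) b = b := (hf _ _).2 h
  refine ⟨?_, fun hboth => hab ((hex hv ha hr hboth.1).trans (hex hv hb hr hboth.2).symm)⟩
  rcases H.eq_or_eq hM hf hab h ((hf _ _).1 hv).symm with rfl | rfl
  · exact Or.inl hQ
  · exact Or.inr hQ

/-- The chain from `x` to `w` avoids their mates `x'` and `w'`, so the exchange of `f x` and `f w`
on it pairs `x` with `w'` and `w` with `x'`. Defect neighbors of `a` remain so. Were `a` joined to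
just one of `x` and `w`, it would be joined to both members of a new pair. -/
theorem AllClassesLarge.defectAdj_iff_of_defectAdj (H : AllClassesLarge G C)
    (hV : Even (Fintype.card V)) (hM : M.IsTotal) (hf : ∀ c v, M.nbr c v = v ↔ c = f v)
    [Fintype C] {x w a : V} (hxw : M.DefectAdj x w) (hax : f a ≠ f x) (haw : f a ≠ f w) :
    M.DefectAdj a x ↔ M.DefectAdj a w := by
  obtain ⟨x', hx', hfx'⟩ := H.exists_mate hV hM hf x
  obtain ⟨w', hw', hfw'⟩ := H.exists_mate hV hM hf w
  have hfxw : f x ≠ f w := fun h => H.not_defectAdj_of_eq hV hM hf h.symm hxw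
  have hlink := H.linked_of_defectAdj hV hM hf hxw
  have hmx : M.nbr (f x) x = x := (hf _ _).2 rfl
  have hmw : M.nbr (f w) w = w := (hf _ _).2 rfl
  let K : Set V := {u | M.Linked (f x) (f w) x u}
  have hK : ∀ v ∈ K, M.nbr (f x) v ∈ K ∧ M.nbr (f w) v ∈ K := fun v hv => hv.closed (Or.inl hmx)
  have hxK : x ∈ K := Linked.refl _ _ _ _
  have hwK : w ∈ K := hlink
  have hw'K : w' ∉ K := fun h =>
    hw' (Linked.eq_of_missing hmx ((hf _ _).2 hfw'.symm) hmw h hlink)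
  have hx'K : x' ∉ K := fun h =>
    hx' (Linked.eq_of_missing hmw ((hf _ _).2 hfx'.symm) hmx
      ((M.linked_comm.1 hlink.symm).trans (M.linked_comm.1 h)) (M.linked_comm.1 hlink.symm))
  let N := M.kempeSwap (f x) (f w) K hK
  have hN : N.IsTotal := hM.kempeSwap
  let g : V → C := fun v => if v ∈ K then Equiv.swap (f x) (f w) (f v) else f v
  have hg : ∀ c v, N.nbr c v = v ↔ c = g v := by
    intro c v
    by_cases hv : v ∈ K
    · simp only [N, g, kempeSwap_nbr_of_mem hv, hf, if_pos hv]
      exact Equiv.swap_apply_eq_iff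
    · simp only [N, g, kempeSwap_nbr_of_notMem hv, hf, if_neg hv]
  have gx : g x = f w := by simp [g, hxK]
  have gw : g w = f x := by simp [g, hwK]
  have gx' : g x' = f x := by simp [g, hx'K, hfx']
  have gw' : g w' = f w := by simp [g, hw'K, hfw']
  have hQ : ∀ {z}, M.DefectAdj a z → N.DefectAdj a z := by
    rintro z ⟨hza, e, u, hu, hez⟩
    refine ⟨hza, ?_⟩
    by_cases h1 : e = f x
    · by_cases haK : a ∈ K
      · exact ⟨f w, x, (hg _ _).2 gx.symm, by
          simp only [N]
          rw [kempeSwap_nbr_of_mem haK, Equiv.swap_apply_right, ← h1, hez]⟩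
      · exact ⟨f x, w, (hg _ _).2 gw.symm, by
          simp only [N]
          rw [kempeSwap_nbr_of_notMem haK, ← h1, hez]⟩
    · by_cases h2 : e = f w
      · by_cases haK : a ∈ K
        · exact ⟨f x, w, (hg _ _).2 gw.symm, by
            simp only [N]
            rw [kempeSwap_nbr_of_mem haK, Equiv.swap_apply_left, ← h2, hez]⟩
        · exact ⟨f w, x, (hg _ _).2 gx.symm, by
            simp only [N]
            rw [kempeSwap_nbr_of_notMem haK, ← h2, hez]⟩
      · exact ⟨e, u, by simpa only [N, kempeSwap_nbr_of_ne h1 h2] using hu,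
          by simpa only [N, kempeSwap_nbr_of_ne h1 h2] using hez⟩
  have nax : a ≠ x := by rintro rfl; exact hax rfl
  have nax' : a ≠ x' := by rintro rfl; exact hax hfx'
  have naw : a ≠ w := by rintro rfl; exact haw rfl
  have naw' : a ≠ w' := by rintro rfl; exact haw hfw'
  constructor
  · intro h
    by_contra hn
    have h2 := (H.defectAdj_or hV hM hf hw'.symm hfw'.symm naw naw').1.resolve_left hn
    refine (H.defectAdj_or hV hN hg (x := a) (a := x) (b := w') ?_ (gx.trans gw'.symm)
      nax naw').2 ⟨hQ h, hQ h2⟩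
    rintro rfl
    exact hw'K hxK
  · intro h
    by_contra hn
    have h2 := (H.defectAdj_or hV hM hf hx'.symm hfx'.symm nax nax').1.resolve_left hn
    refine (H.defectAdj_or hV hN hg (x := a) (a := w) (b := x') ?_ (gw.trans gx'.symm)
      naw nax').2 ⟨hQ h, hQ h2⟩
    rintro rfl
    exact hx'K hwK

theorem AllClassesLarge.defectAdj_trans (H : AllClassesLarge G C)
    (hV : Even (Fintype.card V)) (hM : M.IsTotal) (hf : ∀ c v, M.nbr c v = v ↔ c = f v)
    [Fintype C] {x w a : V} (hxw : M.DefectAdj x w) (hwa : M.DefectAdj w a) (hne : x ≠ a) :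
    M.DefectAdj x a := by
  by_cases h1 : f a = f w
  · exact absurd hwa (H.not_defectAdj_of_eq hV hM hf h1)
  by_cases h2 : f a = f x
  · exact absurd ⟨hxw.symm, hwa⟩
      (H.defectAdj_or hV hM hf hne h2.symm hxw.1 hwa.1.symm).2
  exact ((H.defectAdj_iff_of_defectAdj hV hM hf hxw h2 h1).2 hwa.symm).symm

/-- Defect adjacency is the adjacency of a disjoint union of two complete graphs. -/
theorem AllClassesLarge.exists_partition (H : AllClassesLarge G C)
    (hV : Even (Fintype.card V)) (hM : M.IsTotal) (hf : ∀ c v, M.nbr c v = v ↔ c = f v)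
    [Fintype C] [Nonempty V] :
    ∃ p : V → Bool, (∀ u w, M.DefectAdj u w ↔ u ≠ w ∧ p u = p w) ∧
      ∀ u w, u ≠ w → f u = f w → p u ≠ p w := by
  obtain ⟨x⟩ := ‹Nonempty V›
  obtain ⟨x', hx', hfx'⟩ := H.exists_mate hV hM hf x
  have htr : ∀ {u v w}, M.DefectAdj u v → M.DefectAdj v w → u ≠ w → M.DefectAdj u w :=
    fun h1 h2 h3 => H.defectAdj_trans hV hM hf h1 h2 h3
  have hor : ∀ u, ¬ (u = x ∨ M.DefectAdj x u) → u = x' ∨ M.DefectAdj x' u := by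
    intro u hu
    push Not at hu
    by_cases h : u = x'
    · exact Or.inl h
    · exact Or.inr ((H.defectAdj_or hV hM hf hx'.symm hfx'.symm hu.1 h).1.resolve_left
        fun h' => hu.2 h'.symm).symm
  have hcl : ∀ {z u w}, (u = z ∨ M.DefectAdj z u) → (w = z ∨ M.DefectAdj z w) → u ≠ w →
      M.DefectAdj u w := by
    rintro z u w (rfl | hu) (rfl | hw) hne
    · exact absurd rfl hne
    · exact hw
    · exact hu.symm
    · exact htr hu.symm hw hne
  have hst : ∀ {u w}, M.DefectAdj u w → (u = x ∨ M.DefectAdj x u) →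
      (w = x ∨ M.DefectAdj x w) := by
    rintro u w h (rfl | hu)
    · exact Or.inr h
    · by_cases hw : w = x
      · exact Or.inl hw
      · exact Or.inr (htr hu h (Ne.symm hw))
  have key : ∀ u w, M.DefectAdj u w ↔ u ≠ w ∧
      decide (u = x ∨ M.DefectAdj x u) = decide (w = x ∨ M.DefectAdj x w) := by
    intro u w
    rw [decide_eq_decide]
    refine ⟨fun h => ⟨h.1.symm, hst h, hst h.symm⟩, fun ⟨hne, h⟩ => ?_⟩
    by_cases hu : u = x ∨ M.DefectAdj x u
    · exact hcl hu (h.1 hu) hne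
    · exact hcl (hor u hu) (hor w fun hw => hu (h.2 hw)) hne
  exact ⟨_, key, fun u w hne hfw hp =>
    H.not_defectAdj_of_eq hV hM hf hfw.symm ((key u w).2 ⟨hne, hp⟩)⟩

/-- A color missing at a vertex `x` of the part has all its edges inside parts, and `x` is the only
vertex of its part that it leaves uncovered. -/
theorem AllClassesLarge.odd_card_part (H : AllClassesLarge G C)
    (hV : Even (Fintype.card V)) (hM : M.IsTotal) (hf : ∀ c v, M.nbr c v = v ↔ c = f v)
    [Nonempty V] {p : V → Bool} (hp : ∀ u w, M.DefectAdj u w ↔ u ≠ w ∧ p u = p w)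
    (hp' : ∀ u w, u ≠ w → f u = f w → p u ≠ p w) :
    Odd (Finset.univ.filter fun v => p v = true).card := by
  obtain ⟨x, hx⟩ : ∃ x, p x = true := by
    obtain ⟨x⟩ := ‹Nonempty V›
    obtain ⟨x', hx', hfx'⟩ := H.exists_mate hV hM hf x
    have := hp' x' x hx' hfx'
    cases h : p x
    · exact ⟨x', by simpa [h] using this⟩
    · exact ⟨x, h⟩
  set A := Finset.univ.filter fun v => p v = true with hA
  have h1 := M.even_card_covered (f x) A (by
    intro v hv
    by_cases h : M.nbr (f x) v = v
    · rwa [h]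
    · have := ((hp v _).1 ⟨h, f x, x, (hf _ _).2 rfl, rfl⟩).2
      simpa [hA, ← this] using hv)
  have h2 : A.filter (fun v => M.nbr (f x) v = v) = {x} := by
    ext v
    simp only [hA, Finset.mem_filter, Finset.mem_univ, true_and, Finset.mem_singleton, hf]
    constructor
    · rintro ⟨hv, h⟩
      by_contra hne
      exact hp' v x hne h.symm (hv.trans hx.symm)
    · rintro rfl
      exact ⟨hx, rfl⟩
  have h3 := Finset.card_filter_add_card_filter_not (s := A) (fun v => M.nbr (f x) v = v)
  rw [h2, Finset.card_singleton] at h3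
  rw [← h3]
  exact h1.one_add

theorem AllClassesLarge.card_part_eq (H : AllClassesLarge G C)
    (hV : Even (Fintype.card V)) (hM : M.IsTotal) (hf : ∀ c v, M.nbr c v = v ↔ c = f v)
    {p : V → Bool} (hp' : ∀ u w, u ≠ w → f u = f w → p u ≠ p w) :
    (Finset.univ.filter fun v => p v = true).card =
      (Finset.univ.filter fun v => p v = false).card := by
  have key : ∀ b, (Finset.univ.filter fun v => p v = b).card = (Finset.univ.image f).card := by
    intro b
    have hinj : Set.InjOn f (Finset.univ.filter fun v => p v = b : Finset V) := by
      intro u hu w hw h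
      by_contra hne
      refine hp' u w hne h ?_
      simp only [Finset.coe_filter, Finset.mem_univ, true_and] at hu hw
      exact hu.trans hw.symm
    rw [← Finset.card_image_of_injOn hinj]
    congr 1
    ext c
    simp only [Finset.mem_image, Finset.mem_filter, Finset.mem_univ, true_and]
    constructor
    · rintro ⟨v, -, h⟩
      exact ⟨v, h⟩
    · rintro ⟨v, rfl⟩
      by_cases hv : p v = b
      · exact ⟨v, hv, rfl⟩
      · obtain ⟨w, hw, hfw⟩ := H.exists_mate hV hM hf v
        refine ⟨w, ?_, hfw⟩
        have := hp' w v hw hfw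
        revert hv this
        cases p w <;> cases p v <;> cases b <;> simp
  rw [key, key]

/-- If each vertex misses exactly one color, then each color is missing somewhere: otherwise a
color that is not missing could be disposed of. -/
theorem AllClassesLarge.exists_missing (H : AllClassesLarge G C) (hV : 2 < Fintype.card V)
    (hM : M.IsTotal) (hf : ∀ c v, M.nbr c v = v ↔ c = f v)
    {p : V → Bool} (hp : ∀ u w, M.DefectAdj u w ↔ u ≠ w ∧ p u = p w)
    (c : C) : ∃ v, c = f v := by
  by_contra! hc
  have hperf : ∀ {d}, (∀ v, d ≠ f v) → ∀ v, p (M.nbr d v) ≠ p v := by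
    intro d hd v h
    have hv : M.nbr d v ≠ v := fun h => hd v ((hf _ _).1 h)
    obtain ⟨-, e, u, hu, he⟩ := (hp v (M.nbr d v)).2 ⟨hv.symm, h.symm⟩
    have := M.inj d e v hv he.symm
    exact hd u (this ▸ (hf _ _).1 hu)
  have hdef : ∀ u v, p (M.nbr (f u) v) = p v := by
    intro u v
    by_cases h : M.nbr (f u) v = v
    · rw [h]
    · exact ((hp v _).1 ⟨h, f u, u, (hf _ _).2 rfl, rfl⟩).2.symm
  have hcp := hperf hc
  have hci := M.invol c
  -- On the part `true` keep the old edges; on the other part use their images under the matching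
  -- `c`. The matching edge at `v` in the part `true` gets the color `f v`, now free at both its
  -- ends.
  let g : C → V → V := fun d v =>
    if p v = true then (if M.nbr d v = v then M.nbr c v else M.nbr d v)
    else (if M.nbr d (M.nbr c v) = M.nbr c v then M.nbr c v else M.nbr c (M.nbr d (M.nbr c v)))
  have hpb : ∀ v, p v ≠ true → p (M.nbr c v) = true := by
    intro v hv
    have := hcp v
    revert hv this
    cases p v <;> cases p (M.nbr c v) <;> simp
  have hpb' : ∀ v, p v = true → p (M.nbr c v) ≠ true := fun v hv h => hcp v (h.trans hv.symm)
  have g1 : ∀ {d v}, p v = true → M.nbr d v = v → g d v = M.nbr c v := by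
    intro d v h1 h2; simp [g, h1, h2]
  have g2 : ∀ {d v}, p v = true → M.nbr d v ≠ v → g d v = M.nbr d v := by
    intro d v h1 h2; simp [g, h1, h2]
  have g3 : ∀ {d v}, p v ≠ true → M.nbr d (M.nbr c v) = M.nbr c v → g d v = M.nbr c v := by
    intro d v h1 h2; simp [g, h1, h2]
  have g4 : ∀ {d v}, p v ≠ true → M.nbr d (M.nbr c v) ≠ M.nbr c v →
      g d v = M.nbr c (M.nbr d (M.nbr c v)) := by
    intro d v h1 h2; simp [g, h1, h2]
  have hcross : ∀ u v, p (M.nbr c (M.nbr (f u) (M.nbr c v))) = p v := by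
    intro u v
    have h1 := hcp (M.nbr (f u) (M.nbr c v))
    have h2 := hcp v
    rw [hdef] at h1
    revert h1 h2
    cases p v <;> cases p (M.nbr c v) <;> cases p (M.nbr c (M.nbr (f u) (M.nbr c v))) <;> simp
  have hginv : ∀ u v, g (f u) (g (f u) v) = v := by
    intro u v
    have hi := M.invol (f u)
    by_cases hv : p v = true
    · by_cases h : M.nbr (f u) v = v
      · rw [g1 hv h, g3 (hpb' v hv) (by rw [hci, h]), hci]
      · rw [g2 hv h, g2 ((hdef u v).trans hv) (by rw [hi]; exact Ne.symm h), hi]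
    · by_cases h : M.nbr (f u) (M.nbr c v) = M.nbr c v
      · rw [g3 hv h, g1 (hpb v hv) h, hci]
      · rw [g4 hv h, g4 (by rwa [hcross]) (by rw [hci, hi]; exact Ne.symm h), hci, hi, hci]
  have hgdef : ∀ u v, g (f u) v ≠ v → g (f u) v = M.nbr c v ∨ M.DefectAdj v (g (f u) v) := by
    intro u v hne
    by_cases hv : p v = true
    · by_cases h : M.nbr (f u) v = v
      · exact Or.inl (g1 hv h)
      · rw [g2 hv h]
        exact Or.inr ⟨h, f u, u, (hf _ _).2 rfl, rfl⟩
    · by_cases h : M.nbr (f u) (M.nbr c v) = M.nbr c v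
      · exact Or.inl (g3 hv h)
      · refine Or.inr ((hp _ _).2 ⟨hne.symm, ?_⟩)
        rw [g4 hv h, hcross]
  have hginj : ∀ u w v, g (f u) v = g (f w) v → f u = f w := by
    intro u w v h
    by_cases hv : p v = true
    · by_cases h1 : M.nbr (f u) v = v <;> by_cases h2 : M.nbr (f w) v = v
      · rw [(hf _ _).1 h1, (hf _ _).1 h2]
      · rw [g1 hv h1, g2 hv h2] at h
        exact absurd (h ▸ hdef w v) (hcp v)
      · rw [g2 hv h1, g1 hv h2] at h
        exact absurd (h ▸ hdef u v) (hcp v)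
      · rw [g2 hv h1, g2 hv h2] at h
        exact M.inj _ _ v h1 h
    · by_cases h1 : M.nbr (f u) (M.nbr c v) = M.nbr c v <;>
        by_cases h2 : M.nbr (f w) (M.nbr c v) = M.nbr c v
      · rw [(hf _ _).1 h1, (hf _ _).1 h2]
      · rw [g3 hv h1, g4 hv h2] at h
        exact absurd ((congrArg p h).trans (hcross w v)) (hcp v)
      · rw [g4 hv h1, g3 hv h2] at h
        exact absurd ((congrArg p h).symm.trans (hcross u v)) (hcp v)
      · rw [g4 hv h1, g4 hv h2] at h
        exact M.inj _ _ _ h1 (M.nbr_injective c h)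
  -- The other colors missing nowhere also run between the parts, so they meet neither the edges
  -- inside parts nor those of `c`.
  have hgperf : ∀ {d}, d ≠ c → (∀ u, d ≠ f u) → ∀ u v, g (f u) v ≠ v → g (f u) v ≠ M.nbr d v := by
    intro d hdc hd u v hne h
    rcases hgdef u v hne with h1 | h1
    · exact hdc (M.inj d c v (h ▸ hne) (h.symm.trans h1))
    · exact hperf hd v (h ▸ ((hp _ _).1 h1).2.symm)
  let N : PartialEdgeColoring G C :=
    { nbr := fun d v => if d = c then v else if ∃ u, d = f u then g d v else M.nbr d v
      invol := by
        intro d v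
        split_ifs with h1 h2
        · rfl
        · obtain ⟨u, rfl⟩ := h2
          exact hginv u v
        · exact M.invol d v
      adj := by
        intro d v
        split_ifs with h1 h2
        · exact fun h => absurd rfl h
        · obtain ⟨u, rfl⟩ := h2
          intro h
          rcases hgdef u v h with h3 | h3
          · rw [h3] at h ⊢
            exact M.adj c v h
          · exact h3.adj
        · exact M.adj d v
      inj := by
        intro d e v
        split_ifs with h1 h2 h3 h4 h5 h6 h7 h8
        · exact fun h => absurd rfl h
        · exact fun h => absurd rfl h
        · exact fun h => absurd rfl h
        · exact fun h h' => absurd h' h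
        · obtain ⟨u, rfl⟩ := h4
          obtain ⟨w, rfl⟩ := h6
          exact fun _ h' => hginj u w v h'
        · obtain ⟨u, rfl⟩ := h4
          push Not at h6
          exact fun h h' => absurd h' (hgperf h5 h6 u v h)
        · exact fun h h' => absurd h' h
        · obtain ⟨u, rfl⟩ := h8
          push Not at h4
          exact fun h h' => absurd h'.symm (hgperf h1 h4 u v (h' ▸ h))
        · exact M.inj d e v }
  have hNf : ∀ u v, N.nbr (f u) v = g (f u) v := by
    intro u v
    have : f u ≠ c := fun h => hc u h.symm
    simp [N, this]
  have hN : N.IsTotal := by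
    intro u v huv
    obtain ⟨d, rfl⟩ := hM u v huv
    by_cases hdc : d = c
    · subst hdc
      by_cases hu : p u = true
      · exact ⟨f u, by rw [hNf, g1 hu ((hf _ _).2 rfl)]⟩
      · exact ⟨f (M.nbr d u), by rw [hNf, g3 hu ((hf _ _).2 rfl)]⟩
    · by_cases hd : ∃ w, d = f w
      · obtain ⟨w, rfl⟩ := hd
        have hQ : M.DefectAdj u (M.nbr (f w) u) := ⟨huv.ne', f w, w, (hf _ _).2 rfl, rfl⟩
        by_cases hu : p u = true
        · exact ⟨f w, by rw [hNf, g2 hu hQ.1]⟩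
        · have hQ' : M.DefectAdj (M.nbr c u) (M.nbr c (M.nbr (f w) u)) := by
            refine (hp _ _).2 ⟨fun h => hQ.1 (M.nbr_injective c h).symm, ?_⟩
            have h1 := hcross w (M.nbr c u)
            rw [hci] at h1
            exact h1.symm
          obtain ⟨h1, e, z, hz, he⟩ := hQ'
          obtain rfl := (hf _ _).1 hz
          exact ⟨f z, by rw [hNf, g4 hu (by rw [he]; exact h1), he, hci]⟩
      · exact ⟨d, by simp [N, hdc, hd]⟩
  -- The coloring `N` is total but does not use `c`, which is thus missing at more than two
  -- vertices.
  have h1 := H N hN c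
  have h2 : N.missingAt c = Finset.univ := by
    ext v
    simp [N]
  rw [h2, Finset.card_univ] at h1
  omega

end Regular

/-- A graph in which all color classes of all proper `(Δ + 1)`-edge colorings are large is the
disjoint union of two complete graphs of odd order. -/
theorem AllClassesLarge.exists_clique_partition [Fintype C] (H : AllClassesLarge G C)
    (hV : 2 < Fintype.card V) (hV' : Even (Fintype.card V)) {M : PartialEdgeColoring G C}
    (hM : M.IsTotal) (hne : ∀ v, ∃ c, M.nbr c v = v) :
    ∃ p : V → Bool, (∀ u w, G.Adj u w ↔ u ≠ w ∧ p u = p w) ∧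
      ((Finset.univ.filter fun v => p v = true).card = 1 ∨
        (Odd (Finset.univ.filter fun v => p v = true).card ∧
          (Finset.univ.filter fun v => p v = true).card =
            (Finset.univ.filter fun v => p v = false).card)) := by
  have : Nonempty V := Fintype.card_pos_iff.1 (by omega)
  by_cases h : ∃ v, 2 < (M.missing v).card
  · obtain ⟨v, hv⟩ := h
    obtain ⟨h1, h2⟩ := H.isolated_of_two_lt_card_missing hV hV' hM hne hv
    refine ⟨fun u => decide (u = v), fun u w => ?_, Or.inl ?_⟩
    · rw [decide_eq_decide]
      constructor
      · intro h
        refine ⟨h.ne, iff_of_false ?_ ?_⟩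
        · rintro rfl
          exact h1 _ h
        · rintro rfl
          exact h1 _ h.symm
      · rintro ⟨hne, h⟩
        have hu : u ≠ v := fun hu => hne (hu.trans (h.1 hu).symm)
        exact h2 u w hu (fun hw => hu (h.2 hw)) hne
    · rw [Finset.card_eq_one]
      exact ⟨v, by ext u; simp⟩
  · push Not at h
    have hone := H.card_missing_eq_one hV hV' hM hne h
    choose f hf' using fun v => Finset.card_eq_one.1 (hone v)
    have hf : ∀ c v, M.nbr c v = v ↔ c = f v := by
      intro c v
      rw [← mem_missing, hf', Finset.mem_singleton]
    obtain ⟨p, hp, hp'⟩ := H.exists_partition hV' hM hf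
    refine ⟨p, fun u w => ?_, Or.inr ⟨H.odd_card_part hV' hM hf hp hp',
      H.card_part_eq hV' hM hf hp'⟩⟩
    rw [← hp]
    refine ⟨fun huw => ?_, DefectAdj.adj⟩
    obtain ⟨c, hc⟩ := hM u w huw
    obtain ⟨v, rfl⟩ := H.exists_missing hV hM hf hp c
    exact ⟨huw.ne', f v, v, (hf _ _).2 rfl, hc⟩

end PartialEdgeColoring
end SimpleGraph

namespace SimpleGraph

open scoped Classical

variable {V : Type*} [Fintype V] {G : SimpleGraph V}

/-! ### Disjoint unions of two complete graphs -/

theorem nonempty_iso_sum_completeGraph_iff {a b : ℕ} :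
    Nonempty (G ≃g SimpleGraph.sum (SimpleGraph.completeGraph (Fin a))
      (SimpleGraph.completeGraph (Fin b))) ↔
      ∃ p : V → Bool, (∀ u w, G.Adj u w ↔ u ≠ w ∧ p u = p w) ∧
        (Finset.univ.filter fun v => p v = true).card = a ∧
        (Finset.univ.filter fun v => p v = false).card = b := by
  constructor
  · rintro ⟨e⟩
    refine ⟨fun v => (e v).isLeft, fun u w => ?_, ?_, ?_⟩
    · rw [← e.map_adj_iff, ← e.injective.ne_iff (x := u)]
      beta_reduce
      rcases e u with i | i <;> rcases e w with j | j <;> simp [completeGraph]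
    · have := Finset.card_bij (s := Finset.univ.filter fun v => (e v).isLeft = true)
        (t := (Finset.univ : Finset (Fin a)).map Function.Embedding.inl (β := Fin a ⊕ Fin b))
        (fun v _ => e v) (by
          intro v hv
          obtain ⟨i, hi⟩ := Sum.isLeft_iff.1 (by simpa using hv : (e v).isLeft = true)
          simp [hi]) (fun _ _ _ _ h => e.injective h) (by
          intro x hx
          simp only [Finset.mem_map, Finset.mem_univ, true_and] at hx
          obtain ⟨i, rfl⟩ := hx
          exact ⟨e.symm (Sum.inl i), by simp, by simp⟩)
      simpa using this
    · have := Finset.card_bij (s := Finset.univ.filter fun v => (e v).isLeft = false)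
        (t := (Finset.univ : Finset (Fin b)).map Function.Embedding.inr (β := Fin a ⊕ Fin b))
        (fun v _ => e v) (by
          intro v hv
          obtain ⟨i, hi⟩ := Sum.isRight_iff.1 (by simpa using hv : (e v).isRight = true)
          simp [hi]) (fun _ _ _ _ h => e.injective h) (by
          intro x hx
          simp only [Finset.mem_map, Finset.mem_univ, true_and] at hx
          obtain ⟨i, rfl⟩ := hx
          exact ⟨e.symm (Sum.inr i), by simp, by simp⟩)
      simpa using this
  · rintro ⟨p, hp, ha, hb⟩
    have ea : {v // p v = true} ≃ Fin a := Fintype.equivFinOfCardEq (by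
      rw [Fintype.card_subtype, ha])
    have eb : {v // ¬ p v = true} ≃ Fin b := Fintype.equivFinOfCardEq (by
      rw [Fintype.card_subtype, ← hb]
      simp)
    let e := (Equiv.sumCompl fun v => p v = true).symm.trans (Equiv.sumCongr ea eb)
    refine ⟨⟨e, ?_⟩⟩
    intro u w
    rw [hp]
    by_cases hu : p u = true <;> by_cases hw : p w = true
    · simp [e, Equiv.sumCompl_symm_apply_of_pos, hu, hw, completeGraph]
    · simp [e, Equiv.sumCompl_symm_apply_of_pos, Equiv.sumCompl_symm_apply_of_neg, hu, hw,
        completeGraph]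
    · simp [e, Equiv.sumCompl_symm_apply_of_pos, Equiv.sumCompl_symm_apply_of_neg, hu, hw,
        completeGraph]
    · simp [e, Equiv.sumCompl_symm_apply_of_neg, hu, hw, completeGraph]

/-! ### Counting edges in two disjoint odd cliques. -/

section Partition

variable {p : V → Bool} (hp : ∀ u w, G.Adj u w ↔ u ≠ w ∧ p u = p w)
include hp

theorem degree_add_one_of_partition [DecidableRel G.Adj] (v : V) :
    G.degree v + 1 = (Finset.univ.filter fun w => p w = p v).card := by
  rw [← G.card_neighborFinset_eq_degree, ← Finset.card_erase_add_one
    (a := v) (s := Finset.univ.filter fun w => p w = p v) (by simp)]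
  refine congrArg (fun s : Finset V => s.card + 1) ?_
  ext w
  simp only [mem_neighborFinset, hp, Finset.mem_erase, Finset.mem_filter, Finset.mem_univ,
    true_and]
  exact ⟨fun h => ⟨h.1.symm, h.2.symm⟩, fun h => ⟨h.1.symm, h.2.symm⟩⟩

omit hp in
theorem sum_card_part (p : V → Bool) :
    ∑ v, (Finset.univ.filter fun w => p w = p v).card =
      (Finset.univ.filter fun v => p v = true).card ^ 2 +
        (Finset.univ.filter fun v => p v = false).card ^ 2 := by
  have h : ∀ b, ∑ v ∈ Finset.univ.filter (fun v => p v = b),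
      (Finset.univ.filter fun w => p w = p v).card =
        (Finset.univ.filter fun v => p v = b).card ^ 2 := by
    intro b
    rw [sq, ← smul_eq_mul, ← Finset.sum_const]
    refine Finset.sum_congr rfl fun v hv => ?_
    rw [(Finset.mem_filter.1 hv).2]
  rw [← h, ← h, ← Finset.sum_filter_add_sum_filter_not Finset.univ (fun v => p v = true)]
  simp

/-- A matching in a disjoint union of two complete graphs of odd order leaves a vertex of each of
them uncovered. -/
theorem card_covered_le_of_partition {C : Type*} {H : SimpleGraph V} (hH : H ≤ G)
    (h1 : Odd (Finset.univ.filter fun v => p v = true).card)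
    (h2 : Odd (Finset.univ.filter fun v => p v = false).card)
    (M : PartialEdgeColoring H C) (c : C) :
    (Finset.univ.filter fun v => M.nbr c v ≠ v).card + 2 ≤ Fintype.card V := by
  have hodd : ∀ b, Odd (Finset.univ.filter fun v => p v = b).card := by
    rintro (_ | _)
    · exact h2
    · exact h1
  have hex : ∀ b, ∃ v, p v = b ∧ M.nbr c v = v := by
    intro b
    by_contra! hcon
    have he := M.even_card_covered c (Finset.univ.filter fun v => p v = b) (by
      intro v hv
      have hv' : p v = b := by simpa using hv
      have := ((hp _ _).1 (hH (M.adj c v (hcon v hv')))).2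
      simpa [← this] using hv)
    rw [Finset.filter_true_of_mem (by
      intro v hv
      exact hcon v (by simpa using hv))] at he
    exact (Nat.not_even_iff_odd.2 (hodd b)) he
  obtain ⟨u, hu, hu'⟩ := hex true
  obtain ⟨w, hw, hw'⟩ := hex false
  have huw : u ≠ w := by
    rintro rfl
    simp [hu] at hw
  have h3 := M.card_missingAt_add_card_covered c
  have h4 : ({u, w} : Finset V).card ≤ (M.missingAt c).card := by
    refine Finset.card_le_card ?_
    intro z hz
    simp only [Finset.mem_insert, Finset.mem_singleton] at hz
    rcases hz with rfl | rfl <;> simpa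
  rw [Finset.card_pair huw] at h4
  omega

/-- Any color class shows the upper bound. For the lower bound, `hsum` says that the edges just fill
`Δ + 1` matchings of `n / 2 - 1` edges; after deletion only `Δ` such matchings are available. -/
theorem two_mul_chromaticEdgeStabilityIndex_of_partition [DecidableRel G.Adj] (hG : G.IsClassTwo)
    (h1 : Odd (Finset.univ.filter fun v => p v = true).card)
    (h2 : Odd (Finset.univ.filter fun v => p v = false).card)
    (hsum : ∑ v, G.degree v = (G.maxDegree + 1) * (Fintype.card V - 2)) :
    2 * G.chromaticEdgeStabilityIndex + 2 = Fintype.card V := by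
  obtain ⟨M, hM⟩ := PartialEdgeColoring.exists_total_of_chromaticIndex hG
  have hle := fun c => card_covered_le_of_partition hp le_rfl h1 h2 M c
  have hV : 2 ≤ Fintype.card V := le_trans (Nat.le_add_left _ _) (hle 0)
  refine le_antisymm ?_ ?_
  · have h3 := hM.chromaticEdgeStabilityIndex_le hG 0
    have h4 := M.two_mul_card_colorClass 0
    have h5 := M.card_missingAt_add_card_covered 0
    have h6 := hle 0
    omega
  · obtain ⟨F, hF, hcard, hχ⟩ :=
      PartialEdgeColoring.exists_card_eq_chromaticEdgeStabilityIndex hG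
    obtain ⟨N, hN⟩ := PartialEdgeColoring.exists_total_of_chromaticIndex hχ
    have h3 := hN.sum_degree_eq
    have h4 : ∑ c, (Finset.univ.filter fun v => N.nbr c v ≠ v).card ≤
        ∑ _c : Fin G.maxDegree, (Fintype.card V - 2) := by
      refine Finset.sum_le_sum fun c _ => ?_
      have := card_covered_le_of_partition hp (deleteEdges_le _) h1 h2 N c
      omega
    rw [Finset.sum_const, Finset.card_univ, Fintype.card_fin, smul_eq_mul] at h4
    have h5 := G.sum_degrees_eq_twice_card_edges
    have h6 := (G.deleteEdges (F : Set (Sym2 V))).sum_degrees_eq_twice_card_edges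
    have h7 : (G.deleteEdges (F : Set (Sym2 V))).edgeFinset = G.edgeFinset \ F := by
      ext e
      simp
    have h8 := Finset.card_sdiff_add_card_eq_card (s := F) (t := G.edgeFinset) (by
      intro e he
      exact mem_edgeFinset.2 (hF (Finset.mem_coe.2 he)))
    rw [h7] at h6
    rw [hsum, add_mul, one_mul] at h5
    omega

end Partition

theorem maxDegree_eq_of_partition {p : V → Bool} [DecidableRel G.Adj]
    (hp : ∀ u w, G.Adj u w ↔ u ≠ w ∧ p u = p w) {a b : ℕ}
    (ha : (Finset.univ.filter fun v => p v = true).card = a)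
    (hb : (Finset.univ.filter fun v => p v = false).card = b) (hab : a ≤ b) (hb0 : 0 < b) :
    G.maxDegree + 1 = b := by
  have hd := degree_add_one_of_partition hp
  obtain ⟨v, hv⟩ := Finset.card_pos.1 (hb ▸ hb0)
  have hv' : p v = false := by simpa using hv
  refine le_antisymm ?_ ?_
  · have : Nonempty V := ⟨v⟩
    obtain ⟨w, hw⟩ := G.exists_maximal_degree_vertex
    rw [hw, hd]
    cases h : p w
    · exact hb.le
    · exact ha.le.trans hab
  · have := hd v
    rw [hv', hb] at this
    rw [← this]
    exact Nat.add_le_add_right (G.degree_le_maxDegree v) 1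

theorem card_eq_add_of_partition (p : V → Bool) :
    (Finset.univ.filter fun v => p v = true).card +
      (Finset.univ.filter fun v => p v = false).card = Fintype.card V := by
  have := Finset.card_filter_add_card_filter_not (s := Finset.univ) (fun v => p v = true)
  simpa using this

/-- Deleting any color class is admissible in the definition of the index, so no class has fewer
than `n / 2 - 1` edges. -/
theorem allClassesLarge_of_chromaticEdgeStabilityIndex {k : ℕ}
    (hG : G.chromaticIndex = ((k + 1 : ℕ) : ℕ∞))
    (hes : 2 * G.chromaticEdgeStabilityIndex + 2 = Fintype.card V) :
    PartialEdgeColoring.AllClassesLarge G (Fin (k + 1)) := by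
  intro M hM c
  have h1 := hM.chromaticEdgeStabilityIndex_le hG c
  have h2 := M.two_mul_card_colorClass c
  omega

end SimpleGraph

theorem mainTheorem7 {V : Type*} [Fintype V] (G : SimpleGraph V) [DecidableRel G.Adj]
    (n : ℕ) (hn : Fintype.card V = n) (heven : Even n) (hG : G.IsClassTwo) :
    (G.chromaticEdgeStabilityIndex : ℚ) = (n : ℚ) / 2 - 1 ↔
      (Nonempty (G ≃g SimpleGraph.sum (SimpleGraph.completeGraph (Fin 1))
          (SimpleGraph.completeGraph (Fin (n - 1)))) ∨
        ∃ m : ℕ, 1 ≤ m ∧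
          Nonempty (G ≃g SimpleGraph.sum (SimpleGraph.completeGraph (Fin (2 * m + 1)))
            (SimpleGraph.completeGraph (Fin (2 * m + 1))))) := by
  have hes : (G.chromaticEdgeStabilityIndex : ℚ) = (n : ℚ) / 2 - 1 ↔
      2 * G.chromaticEdgeStabilityIndex + 2 = n := by
    rw [← @Nat.cast_inj ℚ]
    push_cast
    constructor <;> intro h <;> linarith
  rw [hes]
  simp only [SimpleGraph.nonempty_iso_sum_completeGraph_iff]
  subst hn
  constructor
  · intro h
    have hpos := SimpleGraph.PartialEdgeColoring.chromaticEdgeStabilityIndex_pos hG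
    -- The index is positive, which rules out order `2`.
    have hV : 2 < Fintype.card V := by omega
    have H := SimpleGraph.allClassesLarge_of_chromaticEdgeStabilityIndex hG h
    obtain ⟨M, hM⟩ := SimpleGraph.PartialEdgeColoring.exists_total_of_chromaticIndex hG
    have hne : ∀ v, ∃ c, M.nbr c v = v := by
      intro v
      have h1 := hM.card_missing_add_degree v
      have h2 := G.degree_le_maxDegree v
      rw [Fintype.card_fin] at h1
      obtain ⟨c, hc⟩ := Finset.card_pos.1 (by omega : 0 < (M.missing v).card)
      exact ⟨c, by simpa using hc⟩
    obtain ⟨p, hp, h1 | ⟨⟨m, hm⟩, h2⟩⟩ := H.exists_clique_partition hV heven hM hne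
    · have := SimpleGraph.card_eq_add_of_partition p
      exact Or.inl ⟨p, hp, h1, by omega⟩
    · have := SimpleGraph.card_eq_add_of_partition p
      exact Or.inr ⟨m, by omega, p, hp, hm, by omega⟩
  · rintro (⟨p, hp, h1, h2⟩ | ⟨m, hm, p, hp, h1, h2⟩)
    · have hcard := SimpleGraph.card_eq_add_of_partition p
      have hV : 2 ≤ Fintype.card V := by
        obtain ⟨k, hk⟩ := heven
        omega
      have hmax := SimpleGraph.maxDegree_eq_of_partition hp h1 h2 (by omega) (by omega)
      refine SimpleGraph.two_mul_chromaticEdgeStabilityIndex_of_partition hp hG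
        (by rw [h1]; exact odd_one) ?_ ?_
      · rw [h2]
        exact Nat.Even.sub_odd (by omega) heven odd_one
      · have h3 := SimpleGraph.sum_card_part p
        simp_rw [← SimpleGraph.degree_add_one_of_partition hp, Finset.sum_add_distrib] at h3
        rw [h1, h2, Finset.sum_const, Finset.card_univ, smul_eq_mul, mul_one] at h3
        rw [hmax]
        -- Writing the order as `2 + k` removes the truncated subtractions; the claim becomes that
        -- the degree sum is `(k + 1) * k`.
        obtain ⟨k, hk⟩ := Nat.exists_eq_add_of_le hV
        rw [hk] at h3 ⊢
        have e1 : 2 + k - 1 = k + 1 := by omega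
        have e2 : 2 + k - 2 = k := by omega
        rw [e1] at h3 ⊢
        rw [e2]
        nlinarith
    · have hcard := SimpleGraph.card_eq_add_of_partition p
      have hmax := SimpleGraph.maxDegree_eq_of_partition hp h1 h2 le_rfl (by omega)
      refine SimpleGraph.two_mul_chromaticEdgeStabilityIndex_of_partition hp hG
        (by rw [h1]; exact odd_two_mul_add_one m) (by rw [h2]; exact odd_two_mul_add_one m) ?_
      have h3 := SimpleGraph.sum_card_part p
      simp_rw [← SimpleGraph.degree_add_one_of_partition hp, Finset.sum_add_distrib] at h3
      rw [h1, h2, Finset.sum_const, Finset.card_univ, smul_eq_mul, mul_one] at h3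
      rw [hmax]
      have e : Fintype.card V - 2 = 4 * m := by omega
      rw [e]
      have e' : Fintype.card V = 4 * m + 2 := by omega
      rw [e'] at h3
      nlinarith
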